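/- Let $n\ge 1$. Let $\mathcal P$ be the family of Gaussian distributions $p=\mathrm{normal}(\mu,\Sigma)$ on $\mathbb R^n$ with $\Sigma$ positive definite and not diagonal, and let $\mathcal Q$ be the family of Gaussians $q=\mathrm{normal}(\nu,\Psi)$ on $\mathbb R^n$ with $\Psi$ diagonal and $0<\Psi_{ii}<\infty$ for all $i$. Writing $p,q$ also for the densities and $\|v\|_A^2=v^\top A v$, consider the divergences $$\mathrm{KL}(q\|p)=\mathbb E_q\Big[\log\frac qp\Big],\qquad \mathrm{KL}(p\|q)=\mathbb E_p\Big[\log\frac pq\Big],\qquad R_\alpha(p\|q)=\frac1{\alpha(\alpha-1)}\,\mathbb E_q\Big[\frac{p^\alpha}{q^\alpha}-1\Big]\quad(0<\alpha<1),$$ $$S(q\|p)=\mathbb E_q\Big[\big\|\nabla\log\tfrac qp\big\|^2_{\mathrm{Cov}(q)}\Big],\qquad S(p\|q)=\mathbb E_p\Big[\big\|\nabla\log\tfrac qp\big\|^2_{\mathrm{Cov}(p)}\Big].$$ For such a divergence $D$ and $p\in\mathcal P$, call $(\Psi_{11},\dots,\Psi_{nn})\in[0,\infty]^n$ optimal for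 $D$ at $p$ if it is the limit of the marginal variances of a sequence $q_k\in\mathcal Q$ with $D(q_k,p)\to\inf_{q\in\mathcal Q}D(q,p)$. (The variances of any minimizer of $D(\cdot,p)$ in $\mathcal Q$ are optimal; the values $0$ and $\infty$ allow for score-based divergences whose infimum is not attained in $\mathcal Q$.) Write $D_b\prec D_a$ if for every $p\in\mathcal P$ the optimal variances $\Psi^a$ of $D_a$ and $\Psi^b$ of $D_b$ at $p$ exist and are unique, $\Psi^b_{ii}\le\Psi^a_{ii}$ for all $i$, and $\Psi^b_{ii}<\Psi^a_{ii}$ for at least one $i$. Then, for all $0<\alpha_1<\alpha_2<1$, $$S(q\|p)\prec \mathrm{KL}(q\|p)\prec R_{\alpha_1}(p\|q)\prec R_{\alpha_2}(p\|q)\prec \mathrm{KL}(p\|q)\prec S(p\|q).$$ Moreover, for every $p\in\mathcal P$ and $\alpha\in(0,1)$, the divergence $R_\alpha(p\|q)$ attains its minimum over $q\in\mathcal Q$, at some $q$ whose marginal variances $\Psi_{ii}(\alpha)\in(0,\infty)$ are the unique optimal ones, and for each $i$ with $\Sigma_{ii}(\Sigma^{-1})_{ii}>1$ the function $\alpha\mapsto\Psi_{ii}(\alpha)$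 is strictly increasing on $(0,1)$. -/

import Mathlib

open MeasureTheory Filter Topology
open scoped ENNReal Matrix

noncomputable section

namespace FGVI

/-- Euclidean space `ℝⁿ`. -/
abbrev E (n : ℕ) := EuclideanSpace ℝ (Fin n)

/-- The Lebesgue density of `normal(m, C)`, for a positive definite covariance matrix `C`. -/
def gaussianDensity {n : ℕ} (m : E n) (C : Matrix (Fin n) (Fin n) ℝ) (z : E n) : ℝ :=
  (Real.sqrt ((2 * Real.pi) ^ n * C.det))⁻¹ *
    Real.exp (-(1 / 2) * ((z - m).ofLp ⬝ᵥ (C⁻¹ *ᵥ (z - m).ofLp)))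

/-- The density of the factorized Gaussian with mean `ν` and marginal variances `ψ`. -/
def factorizedDensity {n : ℕ} (ν : E n) (ψ : Fin n → ℝ) : E n → ℝ :=
  gaussianDensity ν (Matrix.diagonal ψ)

/-- The variational family `𝒬` of factorized Gaussians (proper distributions: all marginal
variances are positive and finite). -/
def factorizedFamily (n : ℕ) : Set (E n → ℝ) :=
  {q | ∃ (ν : E n) (ψ : Fin n → ℝ), (∀ i, 0 < ψ i) ∧ q = factorizedDensity ν ψ}

/-- The expectation `𝔼_q[f]` under the density `q`. -/
def expect {n : ℕ} (q f : E n → ℝ) : ℝ := ∫ z, q z * f z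

/-- The covariance matrix of the density `q`. -/
def cov {n : ℕ} (q : E n → ℝ) : Matrix (Fin n) (Fin n) ℝ := fun i j =>
  expect q (fun z => (z i - expect q (fun w => w i)) * (z j - expect q (fun w => w j)))

/-- The squared weighted norm `‖v‖²_A = vᵀ A v`. -/
def weightedNormSq {n : ℕ} (A : Matrix (Fin n) (Fin n) ℝ) (v : E n) : ℝ :=
  v.ofLp ⬝ᵥ (A *ᵥ v.ofLp)

/-- A divergence `D(q, p)` as a functional of the densities; the first argument is always the
approximation `q` and the second one the target `p`. -/
abbrev Divergence (n : ℕ) := (E n → ℝ) → (E n → ℝ) → ℝ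

/-- `KL(q||p) = 𝔼_q[log (q/p)]`. -/
def klReverse (n : ℕ) : Divergence n := fun q p =>
  expect q (fun z => Real.log (q z / p z))

/-- `KL(p||q) = 𝔼_p[log (p/q)]`. -/
def klForward (n : ℕ) : Divergence n := fun q p =>
  expect p (fun z => Real.log (p z / q z))

/-- `R_α(p||q) = 1/(α(α-1)) 𝔼_q[p^α/q^α - 1]`. -/
def renyi (n : ℕ) (α : ℝ) : Divergence n := fun q p =>
  1 / (α * (α - 1)) * expect q (fun z => p z ^ α / q z ^ α - 1)

/-- `S(q||p) = 𝔼_q[‖∇ log (q/p)‖²_Cov(q)]`. -/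
def scoreReverse (n : ℕ) : Divergence n := fun q p =>
  expect q (fun z => weightedNormSq (cov q) (gradient (fun w => Real.log (q w / p w)) z))

/-- `S(p||q) = 𝔼_p[‖∇ log (q/p)‖²_Cov(p)]`. -/
def scoreForward (n : ℕ) : Divergence n := fun q p =>
  expect p (fun z => weightedNormSq (cov p) (gradient (fun w => Real.log (q w / p w)) z))

/-- The factorized Gaussian with mean `ν` and marginal variances `ψ` lies in `𝒬` and minimizes
`q ↦ D(q, p)` over `𝒬`. -/
def IsMinimizer {n : ℕ} (D : Divergence n) (p : E n → ℝ) (ν : E n) (ψ : Fin n → ℝ) : Prop :=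
  (∀ i, 0 < ψ i) ∧ ∀ q ∈ factorizedFamily n, D (factorizedDensity ν ψ) p ≤ D q p

/-- `v` is a vector of marginal variances in `[0, ∞]` obtained by minimizing `q ↦ D(q, p)` over
`𝒬`: it is the limit of the marginal variances along a minimizing sequence. A constant sequence
shows that the variances of every minimizer in `𝒬` are of this kind; the values `0` and `∞` occur
when the infimum is only approached as some variances collapse or blow up. -/
def IsOptimalVariances {n : ℕ} (D : Divergence n) (p : E n → ℝ) (v : Fin n → ℝ≥0∞) : Prop :=
  ∃ (ν : ℕ → E n) (ψ : ℕ → Fin n → ℝ) (L : ℝ),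
    (∀ k i, 0 < ψ k i) ∧
    IsGLB ((fun q => D q p) '' factorizedFamily n) L ∧
    Tendsto (fun k => D (factorizedDensity (ν k) (ψ k)) p) atTop (𝓝 L) ∧
    ∀ i, Tendsto (fun k => ENNReal.ofReal (ψ k i)) atTop (𝓝 (v i))

/-- `Da ≻ Db`: for every Gaussian target with non-diagonal covariance, each of the two divergences
determines its vector of optimal marginal variances uniquely, and those of `Da` are at least as
large as those of `Db` in every coordinate and strictly larger in some coordinate. -/
def Dominates {n : ℕ} (Da Db : Divergence n) : Prop :=
  ∀ (μ : E n) (C : Matrix (Fin n) (Fin n) ℝ), C.PosDef → ¬ C.IsDiag →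
    ∃ va vb : Fin n → ℝ≥0∞,
      (∀ v, IsOptimalVariances Da (gaussianDensity μ C) v ↔ v = va) ∧
      (∀ v, IsOptimalVariances Db (gaussianDensity μ C) v ↔ v = vb) ∧
      (∀ i, vb i ≤ va i) ∧ ∃ i, vb i < va i

end FGVI

end

namespace FGVI

/-! Each divergence is minimized over the mean at `ν = μ`, which leaves an explicit function of the
variances `ψ`. Write `Λ = C⁻¹`. For the two KL divergences this function splits into coordinates,
with minimizers `1 / Λ i i` (reverse) and `C i i` (forward). For the scores it is `scoreQuadratic A
s`, with `A = Λ`, `s = ψ` or with `A = C`, `s = 1 / ψ`. Its Hessian is a multiple of `A ⊙ A`,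
positive definite by Schur's product theorem, so it has a unique minimizer on the closed orthant.
One-sided optimality where `s i > 0` gives `s i ≤ 1 / A i i`, and equality for every `i` would make
`A` diagonal.

For `R_α` one minimizes `log det M - α ∑ log ψ i` with `M = α Ψ + (1 - α) C`; a minimizer satisfies
`ψ i * M⁻¹ i i = 1` for all `i`. The comparisons rest on `A⁻¹ i i = max_x (2 x i - xᵀ A x)`, which
makes `A⁻¹ i i` convex in `A`. Convexity between `Ψ` and `C` yields `1 / Λ i i ≤ ψ i`, and a test
vector along `e_i` yields `ψ i ≤ C i i`. For `α < β` the matrix `M_β` built from the same `ψ` lies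
on the segment from `M_α` to `Ψ`, so the solution at `α` is a subsolution at `β`; the comparison
principle `le_of_mul_inv_interpolant_le_one` puts it below the solution at `β`. Equality in the
convexity or test-vector bounds would give `u` with `Ψ u = C u = e_i`, hence `C i i * Λ i i = 1`; a
non-diagonal `C` has an `i` where this product exceeds `1`.

Optimality refers to minimizing sequences. Bounded sublevel sets and a unique minimizer force all of
these to converge (`tendsto_of_tendsto_unique_min`). -/

/-! ### Gaussian densities, their moments and their integrals. -/

open ProbabilityTheory in
lemma stdGaussian_eq_withDensity (n : ℕ) :
    stdGaussian (E n) = (volume : Measure (E n)).withDensity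
      (fun z => ENNReal.ofReal ((Real.sqrt ((2 * Real.pi) ^ n))⁻¹ *
        Real.exp (-(1 / 2) * ‖z‖ ^ 2))) := by
  have hgauss : Integrable (fun z : E n => (Real.sqrt ((2 * Real.pi) ^ n))⁻¹ *
      Real.exp (-(1 / 2) * ‖z‖ ^ 2)) := by
    have h := GaussianFourier.integrable_cexp_neg_mul_sq_norm_add (b := 1 / 2) (by norm_num) 0
      (0 : E n)
    refine (h.norm.congr (ae_of_all _ fun z => ?_)).const_mul _
    simp only [Complex.norm_exp]
    norm_num [← Complex.ofReal_pow]
  have := isFiniteMeasure_withDensity_ofReal hgauss.2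
  apply Measure.ext_of_charFun
  ext t
  rw [charFun_stdGaussian, charFun_apply, integral_withDensity_eq_integral_toReal_smul (by fun_prop)
    (ae_of_all _ fun _ => ENNReal.ofReal_lt_top)]
  have hpos : 0 < (2 * Real.pi) ^ n := by positivity
  have h := GaussianFourier.integral_cexp_neg_mul_sq_norm_add (b := 1 / 2) (by norm_num)
    Complex.I t
  have h2 : ∀ z : E n, (ENNReal.ofReal ((Real.sqrt ((2 * Real.pi) ^ n))⁻¹ *
        Real.exp (-(1 / 2) * ‖z‖ ^ 2))).toReal • Complex.exp (inner ℝ z t * Complex.I) =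
      ((Real.sqrt ((2 * Real.pi) ^ n))⁻¹ : ℂ) *
        Complex.exp (-(1 / 2) * ‖z‖ ^ 2 + Complex.I * inner ℝ t z) := by
    intro z
    rw [ENNReal.toReal_ofReal (by positivity), Complex.real_smul, Complex.exp_add,
      real_inner_comm z t, mul_comm Complex.I]
    push_cast
    ring
  simp_rw [h2]
  rw [integral_const_mul, h]
  have h3 : ((Real.pi / (1 / 2) : ℂ) ^ ((Module.finrank ℝ (E n) : ℂ) / 2)) =
      (Real.sqrt ((2 * Real.pi) ^ n) : ℂ) := by
    rw [Real.sqrt_eq_rpow, ← Real.rpow_natCast, ← Real.rpow_mul (by positivity),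
      Complex.ofReal_cpow (by positivity)]
    simp only [finrank_euclideanSpace, Fintype.card_fin]
    congr 1
    · push_cast; ring
    · push_cast; ring
  rw [h3, ← mul_assoc, inv_mul_cancel₀, one_mul]
  · congr 1
    rw [Complex.I_sq]
    ring
  · exact_mod_cast (Real.sqrt_pos.2 hpos).ne'

lemma continuous_gaussianDensity {n : ℕ} (m : E n) (C : Matrix (Fin n) (Fin n) ℝ) :
    Continuous (gaussianDensity m C) := by
  unfold gaussianDensity Matrix.mulVec dotProduct
  fun_prop

lemma gaussianDensity_pos {n : ℕ} (m : E n) {C : Matrix (Fin n) (Fin n) ℝ} (hC : C.PosDef)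
    (z : E n) : 0 < gaussianDensity m C z := by
  have := hC.det_pos
  unfold gaussianDensity
  positivity

-- Change of variables `z = m + √C w` from the standard Gaussian; the Jacobian `|det √C|` supplies
-- the factor `√(det C)` of the normalization.
open ProbabilityTheory MatrixOrder in
lemma multivariateGaussian_eq_withDensity {n : ℕ} (m : E n) {C : Matrix (Fin n) (Fin n) ℝ}
    (hC : C.PosDef) :
    multivariateGaussian m C = (volume : Measure (E n)).withDensity
      (fun z => ENNReal.ofReal (gaussianDensity m C z)) := by
  set R := CFC.sqrt C with hR
  have hRR : R * R = C := CFC.sqrt_mul_sqrt_self _ hC.posSemidef.nonneg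
  have hRs : Rᵀ = R := by
    have := (CFC.sqrt_nonneg C).isSelfAdjoint
    simpa [IsSelfAdjoint, Matrix.star_eq_conjTranspose] using this
  have hdet : R.det * R.det = C.det := by rw [← Matrix.det_mul, hRR]
  have hCpos := hC.det_pos
  have hRdet : R.det ≠ 0 := fun h => by rw [h] at hdet; simp at hdet; linarith
  set T := Matrix.toEuclideanLin R with hT
  have hTdet : LinearMap.det T = R.det := by
    rw [hT, Matrix.toEuclideanLin, Matrix.toLpLin_eq_toLin, LinearMap.det_toLin]
  have hvol : Measure.map T (volume : Measure (E n)) = ENNReal.ofReal |R.det⁻¹| • volume := by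
    rw [Measure.map_linearMap_addHaar_eq_smul_addHaar _ (by rwa [hTdet]), hTdet]
  have hTc : Continuous T := LinearMap.continuous_of_finiteDimensional T
  have hpt : ∀ w : E n, ENNReal.ofReal ((Real.sqrt ((2 * Real.pi) ^ n))⁻¹ *
        Real.exp (-(1 / 2) * ‖w‖ ^ 2)) =
      ENNReal.ofReal |R.det| * ENNReal.ofReal (gaussianDensity m C (m + T w)) := by
    intro w
    rw [← ENNReal.ofReal_mul (abs_nonneg _)]
    congr 1
    unfold gaussianDensity
    have h1 : (m + T w - m).ofLp = R *ᵥ w.ofLp := by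
      rw [add_sub_cancel_left, hT]; rfl
    have h2 : (R *ᵥ w.ofLp) ⬝ᵥ (C⁻¹ *ᵥ (R *ᵥ w.ofLp)) = ‖w‖ ^ 2 := by
      have h3 : R * C⁻¹ * R = 1 := by
        rw [← hRR, Matrix.mul_inv_rev, ← mul_assoc,
          Matrix.mul_nonsing_inv _ (by simpa using hRdet), one_mul,
          Matrix.nonsing_inv_mul _ (by simpa using hRdet)]
      have h4 : (R *ᵥ w.ofLp) ⬝ᵥ (C⁻¹ *ᵥ (R *ᵥ w.ofLp)) =
          w.ofLp ⬝ᵥ ((R * C⁻¹ * R) *ᵥ w.ofLp) := by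
        have h5 : R *ᵥ w.ofLp = w.ofLp ᵥ* R := by rw [← Matrix.mulVec_transpose, hRs]
        rw [← Matrix.mulVec_mulVec, ← Matrix.mulVec_mulVec, Matrix.dotProduct_mulVec w.ofLp R, ← h5]
      rw [h4, h3, Matrix.one_mulVec, EuclideanSpace.real_norm_sq_eq]
      simp [dotProduct, sq]
    rw [h1, h2, Real.sqrt_mul (by positivity), ← hdet, Real.sqrt_mul_self_eq_abs, mul_inv]
    have := abs_pos.2 hRdet
    field_simp
  have hgm := (continuous_gaussianDensity m C).measurable
  have hdm : Measurable (fun z => ENNReal.ofReal (gaussianDensity m C z)) :=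
    (continuous_gaussianDensity m C).measurable.ennreal_ofReal
  refine Measure.ext_of_lintegral _ fun f hf => ?_
  have hmeas : Measurable (fun x : E n => m + T x) := by fun_prop
  have e1 : multivariateGaussian m C = (stdGaussian (E n)).map (fun x => m + T x) := rfl
  rw [e1, lintegral_map hf hmeas, stdGaussian_eq_withDensity,
    lintegral_withDensity_eq_lintegral_mul _ (by fun_prop)
      (show Measurable fun a => f (m + T a) from hf.comp hmeas),
    lintegral_withDensity_eq_lintegral_mul _ hdm hf]
  simp only [Pi.mul_apply, hpt, mul_assoc]
  rw [lintegral_const_mul _ (by fun_prop),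
    ← lintegral_map (f := fun z => ENNReal.ofReal (gaussianDensity m C (m + z)) * f (m + z))
      (by fun_prop) hTc.measurable, hvol, lintegral_smul_measure,
    lintegral_add_left_eq_self (fun z => ENNReal.ofReal (gaussianDensity m C z) * f z) m,
    smul_eq_mul, ← mul_assoc, ← ENNReal.ofReal_mul (abs_nonneg _), ← abs_mul,
    mul_inv_cancel₀ hRdet]
  simp

open ProbabilityTheory in
lemma expect_gaussianDensity {n : ℕ} (m : E n) {C : Matrix (Fin n) (Fin n) ℝ}
    (hC : C.PosDef) (f : E n → ℝ) :
    expect (gaussianDensity m C) f = ∫ z, f z ∂(multivariateGaussian m C) := by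
  rw [multivariateGaussian_eq_withDensity m hC, integral_withDensity_eq_integral_toReal_smul
    (continuous_gaussianDensity m C).measurable.ennreal_ofReal
    (ae_of_all _ fun _ => ENNReal.ofReal_lt_top)]
  refine integral_congr_ae (ae_of_all _ fun z => ?_)
  simp [ENNReal.toReal_ofReal (gaussianDensity_pos m hC z).le]

lemma integral_gaussianDensity {n : ℕ} (m : E n) {C : Matrix (Fin n) (Fin n) ℝ}
    (hC : C.PosDef) : ∫ z, gaussianDensity m C z = 1 := by
  have := expect_gaussianDensity m hC (fun _ => 1)
  simpa [expect] using this

lemma integrable_gaussianDensity {n : ℕ} (m : E n) {C : Matrix (Fin n) (Fin n) ℝ}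
    (hC : C.PosDef) : Integrable (gaussianDensity m C) := by
  -- A non-integrable function has integral `0` by convention, which contradicts the value `1`.
  by_contra h
  have := integral_gaussianDensity m hC
  rw [integral_undef h] at this
  norm_num at this

open ProbabilityTheory in
lemma integrable_coord_multivariateGaussian {n : ℕ} (m : E n) (C : Matrix (Fin n) (Fin n) ℝ)
    (i : Fin n) : Integrable (fun z : E n => z i) (multivariateGaussian m C) :=
  (EuclideanSpace.proj (𝕜 := ℝ) i).integrable_comp
    (IsGaussian.integrable_id (μ := multivariateGaussian m C))

open ProbabilityTheory in
lemma integral_coord_multivariateGaussian {n : ℕ} (m : E n) (C : Matrix (Fin n) (Fin n) ℝ)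
    (i : Fin n) : ∫ z : E n, z i ∂(multivariateGaussian m C) = m i := by
  have := (EuclideanSpace.proj (𝕜 := ℝ) i).integral_comp_comm
    (IsGaussian.integrable_id (μ := multivariateGaussian m C))
  simpa using this

open ProbabilityTheory in
lemma memLp_coord_sub_multivariateGaussian {n : ℕ} (m : E n) (C : Matrix (Fin n) (Fin n) ℝ)
    (i : Fin n) : MemLp (fun z : E n => z i - m i) 2 (multivariateGaussian m C) :=
  ((EuclideanSpace.proj (𝕜 := ℝ) i).comp_memLp'
    (IsGaussian.memLp_two_id (μ := multivariateGaussian m C))).sub (memLp_const (m i))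

open ProbabilityTheory in
lemma integral_coord_sub_mul_multivariateGaussian {n : ℕ} (m : E n)
    {C : Matrix (Fin n) (Fin n) ℝ} (hC : C.PosDef) (i j : Fin n) :
    ∫ z : E n, (z i - m i) * (z j - m j) ∂(multivariateGaussian m C) = C i j := by
  rw [← covariance_eval_multivariateGaussian (μ := m) hC.posSemidef i j, covariance]
  simp only [integral_coord_multivariateGaussian]

lemma cov_gaussianDensity {n : ℕ} (m : E n) {C : Matrix (Fin n) (Fin n) ℝ}
    (hC : C.PosDef) : cov (gaussianDensity m C) = C := by
  ext i j
  simp only [cov, expect_gaussianDensity m hC, integral_coord_multivariateGaussian]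
  exact integral_coord_sub_mul_multivariateGaussian m hC i j

/-- Only the first two moments enter, and the cross terms vanish because `z - m` is centered. The
affine form `G (z - m) + b` is the shape of the gradient of a log-ratio of Gaussians. -/
lemma expect_quadratic {n : ℕ} (m : E n) {C : Matrix (Fin n) (Fin n) ℝ} (hC : C.PosDef)
    (G W : Matrix (Fin n) (Fin n) ℝ) (b : Fin n → ℝ) :
    expect (gaussianDensity m C) (fun z => (G *ᵥ (z - m).ofLp + b) ⬝ᵥ
      (W *ᵥ (G *ᵥ (z - m).ofLp + b))) = (Gᵀ * W * G * C).trace + b ⬝ᵥ (W *ᵥ b) := by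
  rw [expect_gaussianDensity m hC]
  set H := Gᵀ * W * G with hH
  set l := Gᵀ *ᵥ (W *ᵥ b) + Gᵀ *ᵥ (Wᵀ *ᵥ b) with hl
  have hpt : ∀ z : E n, (G *ᵥ (z - m).ofLp + b) ⬝ᵥ (W *ᵥ (G *ᵥ (z - m).ofLp + b)) =
      ((∑ i, ∑ j, H i j * ((z i - m i) * (z j - m j))) + ∑ i, l i * (z i - m i)) +
        b ⬝ᵥ (W *ᵥ b) := by
    intro z
    have e1 : ∑ i, ∑ j, H i j * ((z i - m i) * (z j - m j)) =
        (z - m).ofLp ⬝ᵥ (H *ᵥ (z - m).ofLp) := by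
      simp only [dotProduct, Matrix.mulVec, Finset.mul_sum]
      refine Finset.sum_congr rfl fun i _ => Finset.sum_congr rfl fun j _ => ?_
      simp; ring
    have e2 : ∑ i, l i * (z i - m i) = l ⬝ᵥ (z - m).ofLp := by simp [dotProduct]
    rw [e1, e2]
    set y := (z - m).ofLp
    have e3 : (G *ᵥ y) ⬝ᵥ (W *ᵥ (G *ᵥ y)) = y ⬝ᵥ (H *ᵥ y) := by
      rw [hH, ← Matrix.mulVec_mulVec, ← Matrix.mulVec_mulVec, Matrix.dotProduct_mulVec y,
        Matrix.vecMul_transpose]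
    have e4 : (G *ᵥ y) ⬝ᵥ (W *ᵥ b) = (Gᵀ *ᵥ (W *ᵥ b)) ⬝ᵥ y := by
      rw [Matrix.mulVec_transpose, ← Matrix.dotProduct_mulVec, dotProduct_comm]
    have e5 : b ⬝ᵥ (W *ᵥ (G *ᵥ y)) = (Gᵀ *ᵥ (Wᵀ *ᵥ b)) ⬝ᵥ y := by
      rw [Matrix.mulVec_transpose, ← Matrix.dotProduct_mulVec, Matrix.mulVec_transpose,
        ← Matrix.dotProduct_mulVec]
    rw [Matrix.mulVec_add, add_dotProduct, dotProduct_add, dotProduct_add, e3, e4, e5, hl,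
      add_dotProduct]
    ring
  have i1 : ∀ i j, Integrable (fun z : E n => H i j * ((z i - m i) * (z j - m j)))
      (ProbabilityTheory.multivariateGaussian m C) := fun i j =>
    ((memLp_coord_sub_multivariateGaussian m C i).integrable_mul
      (memLp_coord_sub_multivariateGaussian m C j)).const_mul _
  have i2 : ∀ i, Integrable (fun z : E n => l i * (z i - m i))
      (ProbabilityTheory.multivariateGaussian m C) := fun i =>
    ((integrable_coord_multivariateGaussian m C i).sub (integrable_const _)).const_mul _
  simp_rw [hpt]
  rw [integral_add _ (integrable_const _), integral_add, integral_finsetSum, integral_finsetSum]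
  · have : ∀ i, ∫ z : E n, ∑ j, H i j * ((z i - m i) * (z j - m j))
        ∂(ProbabilityTheory.multivariateGaussian m C) = ∑ j, H i j * C i j := fun i => by
      rw [integral_finsetSum _ fun j _ => i1 i j]
      simp_rw [integral_const_mul, integral_coord_sub_mul_multivariateGaussian m hC]
    simp_rw [this, integral_const_mul]
    have h0 : ∀ i, ∫ z : E n, (z i - m i) ∂(ProbabilityTheory.multivariateGaussian m C) = 0 := by
      intro i
      rw [integral_sub (integrable_coord_multivariateGaussian m C i) (integrable_const _),
        integral_coord_multivariateGaussian]
      simp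
    simp only [h0, mul_zero, Finset.sum_const_zero, add_zero, integral_const, probReal_univ,
      smul_eq_mul, one_mul]
    congr 1
    have hs : ∀ i j, C i j = C j i := fun i j => by simpa using hC.isHermitian.apply j i
    simp only [Matrix.trace, Matrix.diag, Matrix.mul_apply (M := H) (N := C)]
    exact Finset.sum_congr rfl fun i _ => Finset.sum_congr rfl fun j _ => by rw [hs i j]
  · exact fun i _ => i2 i
  · exact fun i _ => integrable_finsetSum _ fun j _ => i1 i j
  · exact integrable_finsetSum _ fun i _ => integrable_finsetSum _ fun j _ => i1 i j
  · exact integrable_finsetSum _ fun i _ => i2 i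
  · exact (integrable_finsetSum _ fun i _ => integrable_finsetSum _ fun j _ => i1 i j).add
      (integrable_finsetSum _ fun i _ => i2 i)

lemma integral_exp_neg_quadratic {n : ℕ} (c : E n) {P : Matrix (Fin n) (Fin n) ℝ}
    (hP : P.PosDef) :
    ∫ z : E n, Real.exp (-(1 / 2) * ((z - c).ofLp ⬝ᵥ (P *ᵥ (z - c).ofLp))) =
      Real.sqrt ((2 * Real.pi) ^ n / P.det) := by
  have h := integral_gaussianDensity c hP.inv
  simp only [gaussianDensity, Matrix.nonsing_inv_nonsing_inv _ hP.det_pos.ne'.isUnit,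
    integral_const_mul] at h
  rw [inv_mul_eq_one₀] at h
  · rw [← h, Matrix.det_nonsing_inv, Ring.inverse_eq_inv', div_eq_mul_inv]
  · have := hP.inv.det_pos
    positivity

lemma integrable_exp_neg_quadratic {n : ℕ} (c : E n) {P : Matrix (Fin n) (Fin n) ℝ}
    (hP : P.PosDef) :
    Integrable fun z : E n => Real.exp (-(1 / 2) * ((z - c).ofLp ⬝ᵥ (P *ᵥ (z - c).ofLp))) := by
  by_contra h
  have := integral_exp_neg_quadratic c hP
  rw [integral_undef h] at this
  have h2 := hP.det_pos
  have : 0 < Real.sqrt ((2 * Real.pi) ^ n / P.det) := by positivity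
  linarith

/-- A larger quadratic form has a smaller Gaussian integral, and that integral is `√((2π)ⁿ / det)`.
-/
lemma det_le_det_of_forall_dotProduct_le {n : ℕ} {A B : Matrix (Fin n) (Fin n) ℝ}
    (hA : A.PosDef) (hB : B.PosDef) (h : ∀ x, x ⬝ᵥ (A *ᵥ x) ≤ x ⬝ᵥ (B *ᵥ x)) :
    A.det ≤ B.det := by
  have key : Real.sqrt ((2 * Real.pi) ^ n / B.det) ≤ Real.sqrt ((2 * Real.pi) ^ n / A.det) := by
    rw [← integral_exp_neg_quadratic 0 hA, ← integral_exp_neg_quadratic 0 hB]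
    refine integral_mono (integrable_exp_neg_quadratic 0 hB) (integrable_exp_neg_quadratic 0 hA)
      fun z => Real.exp_le_exp.2 ?_
    have := h (z - 0).ofLp
    linarith
  have hAp := hA.det_pos
  have hBp := hB.det_pos
  rw [Real.sqrt_le_sqrt_iff (by positivity), div_le_div_iff_of_pos_left (by positivity) hBp hAp]
    at key
  exact key

/-! ### Log-ratios of Gaussians and their gradients. -/

lemma log_gaussianDensity {n : ℕ} (m : E n) {C : Matrix (Fin n) (Fin n) ℝ} (hC : C.PosDef)
    (z : E n) : Real.log (gaussianDensity m C z) =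
      -(1 / 2) * (Real.log ((2 * Real.pi) ^ n) + Real.log C.det) -
        (1 / 2) * ((z - m).ofLp ⬝ᵥ (C⁻¹ *ᵥ (z - m).ofLp)) := by
  have := hC.det_pos
  have h2 : (0 : ℝ) < (2 * Real.pi) ^ n := by positivity
  rw [gaussianDensity, Real.log_mul (by positivity) (Real.exp_pos _).ne', Real.log_exp,
    Real.log_inv, Real.log_sqrt (by positivity), Real.log_mul h2.ne' this.ne']
  ring

lemma log_gaussianDensity_div {n : ℕ} (m m' : E n) {A B : Matrix (Fin n) (Fin n) ℝ}
    (hA : A.PosDef) (hB : B.PosDef) (z : E n) :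
    Real.log (gaussianDensity m A z / gaussianDensity m' B z) =
      (1 / 2) * (Real.log B.det - Real.log A.det) +
        ((1 / 2) * ((z - m').ofLp ⬝ᵥ (B⁻¹ *ᵥ (z - m').ofLp)) -
          (1 / 2) * ((z - m).ofLp ⬝ᵥ (A⁻¹ *ᵥ (z - m).ofLp))) := by
  rw [Real.log_div (gaussianDensity_pos m hA z).ne' (gaussianDensity_pos m' hB z).ne',
    log_gaussianDensity m hA, log_gaussianDensity m' hB]
  ring

lemma integrable_quadratic_multivariateGaussian {n : ℕ} (m c : E n)
    (C W : Matrix (Fin n) (Fin n) ℝ) :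
    Integrable (fun z : E n => (z - c).ofLp ⬝ᵥ (W *ᵥ (z - c).ofLp))
      (ProbabilityTheory.multivariateGaussian m C) := by
  have hm : ∀ i, MemLp (fun z : E n => z i - c i) 2
      (ProbabilityTheory.multivariateGaussian m C) := fun i => by
    convert! (memLp_coord_sub_multivariateGaussian m C i).add (memLp_const (m i - c i)) using 1
    ext z
    simp
  have : (fun z : E n => (z - c).ofLp ⬝ᵥ (W *ᵥ (z - c).ofLp)) =
      fun z => ∑ i, ∑ j, W i j * ((z i - c i) * (z j - c j)) := by
    ext z
    simp only [dotProduct, Matrix.mulVec, Finset.mul_sum]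
    refine Finset.sum_congr rfl fun i _ => Finset.sum_congr rfl fun j _ => ?_
    simp; ring
  rw [this]
  exact integrable_finsetSum _ fun i _ => integrable_finsetSum _ fun j _ =>
    ((hm i).integrable_mul (hm j)).const_mul _

lemma integral_quadratic_multivariateGaussian {n : ℕ} (m c : E n)
    {C : Matrix (Fin n) (Fin n) ℝ} (hC : C.PosDef) (W : Matrix (Fin n) (Fin n) ℝ) :
    ∫ z : E n, (z - c).ofLp ⬝ᵥ (W *ᵥ (z - c).ofLp)
      ∂(ProbabilityTheory.multivariateGaussian m C) =
      (W * C).trace + (m - c).ofLp ⬝ᵥ (W *ᵥ (m - c).ofLp) := by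
  have h := expect_quadratic m hC 1 W (m - c).ofLp
  rw [expect_gaussianDensity m hC] at h
  simp only [Matrix.one_mulVec, Matrix.transpose_one, one_mul, mul_one, ← WithLp.ofLp_add,
    sub_add_sub_cancel] at h
  exact h

/-- The Kullback-Leibler divergence between two nondegenerate Gaussians. -/
lemma expect_log_gaussianDensity_div {n : ℕ} (m m' : E n) {A B : Matrix (Fin n) (Fin n) ℝ}
    (hA : A.PosDef) (hB : B.PosDef) :
    expect (gaussianDensity m A)
      (fun z => Real.log (gaussianDensity m A z / gaussianDensity m' B z)) = (1 / 2) * (Real.log B.det - Real.log A.det + (B⁻¹ * A).trace - n +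
        (m - m').ofLp ⬝ᵥ (B⁻¹ *ᵥ (m - m').ofLp)) := by
  rw [expect_gaussianDensity m hA]
  simp_rw [log_gaussianDensity_div m m' hA hB]
  have i1 := (integrable_quadratic_multivariateGaussian m m' A B⁻¹).const_mul (1 / 2)
  have i2 := (integrable_quadratic_multivariateGaussian m m A A⁻¹).const_mul (1 / 2)
  rw [integral_add (integrable_const _) (by simpa using! i1.sub i2), integral_sub i1 i2,
    integral_const_mul, integral_const_mul, integral_const_mul,
    integral_quadratic_multivariateGaussian m m' hA,
    integral_quadratic_multivariateGaussian m m hA,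
    Matrix.nonsing_inv_mul _ hA.det_pos.ne'.isUnit]
  simp
  ring

lemma hasGradientAt_quadratic {n : ℕ} (c : E n) {P : Matrix (Fin n) (Fin n) ℝ}
    (hP : P.IsHermitian) (z : E n) :
    HasGradientAt (fun w : E n => (1 / 2 : ℝ) * ((w - c).ofLp ⬝ᵥ (P *ᵥ (w - c).ofLp)))
      (Matrix.toEuclideanLin P (z - c)) z := by
  set T := (Matrix.toEuclideanCLM (𝕜 := ℝ) P)
  have e : (fun w : E n => (1 / 2 : ℝ) * ((w - c).ofLp ⬝ᵥ (P *ᵥ (w - c).ofLp))) =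
      fun w => (1 / 2 : ℝ) * inner ℝ (w - c) (T (w - c)) := by
    ext w
    rw [Matrix.inner_toEuclideanCLM]
  rw [e, hasGradientAt_iff_hasFDerivAt]
  have h1 : HasFDerivAt (fun w : E n => w - c) (ContinuousLinearMap.id ℝ (E n)) z :=
    (hasFDerivAt_id z).sub_const c
  have h2 : HasFDerivAt (fun w : E n => T (w - c)) (T.comp (ContinuousLinearMap.id ℝ (E n))) z :=
    T.hasFDerivAt.comp z h1
  have h3 := (h1.inner ℝ h2).const_mul (1 / 2 : ℝ)
  convert! h3 using 1
  ext v
  have hs : inner ℝ (z - c) (T v) = inner ℝ (T (z - c)) v := by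
    have : IsSelfAdjoint T := by
      have hP' : IsSelfAdjoint P := hP
      exact hP'.map _
    have h4 := ContinuousLinearMap.adjoint_inner_left T v (z - c)
    rw [this.adjoint_eq] at h4
    exact h4.symm
  have ht : (Matrix.toEuclideanLin P) (z - c) = T (z - c) := rfl
  rw [ht]
  change inner ℝ (T (z - c)) v = 1 / 2 * (inner ℝ (z - c) (T v) + inner ℝ v (T (z - c)))
  rw [hs, real_inner_comm v]
  ring

lemma gradient_log_gaussianDensity_div {n : ℕ} (m m' : E n) {A B : Matrix (Fin n) (Fin n) ℝ}
    (hA : A.PosDef) (hB : B.PosDef) (z : E n) :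
    (gradient (fun w => Real.log (gaussianDensity m A w / gaussianDensity m' B w)) z).ofLp =
      B⁻¹ *ᵥ (z - m').ofLp - A⁻¹ *ᵥ (z - m).ofLp := by
  simp_rw [log_gaussianDensity_div m m' hA hB]
  have h : HasGradientAt (fun w : E n => (1 / 2) * (Real.log B.det - Real.log A.det) +
        ((1 / 2) * ((w - m').ofLp ⬝ᵥ (B⁻¹ *ᵥ (w - m').ofLp)) -
          (1 / 2) * ((w - m).ofLp ⬝ᵥ (A⁻¹ *ᵥ (w - m).ofLp))))
      (Matrix.toEuclideanLin B⁻¹ (z - m') - Matrix.toEuclideanLin A⁻¹ (z - m)) z := by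
    rw [hasGradientAt_iff_hasFDerivAt, map_sub]
    exact ((hasGradientAt_quadratic m' hB.inv.isHermitian z).hasFDerivAt.sub
      (hasGradientAt_quadratic m hA.inv.isHermitian z).hasFDerivAt).const_add _
  rw [h.gradient]
  rfl

/-! ### Profiles of the divergences in the variances. -/

/-- The value of the covariance-weighted score divergences for equal means: `A` is the precision
and `s` the variances, or `A` is the covariance and `s` the inverse variances. -/
def scoreQuadratic {n : ℕ} (A : Matrix (Fin n) (Fin n) ℝ) (s : Fin n → ℝ) : ℝ :=
  n - 2 * ∑ i, A i i * s i + ∑ i, ∑ j, s i * s j * A i j ^ 2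

/-- `f` is the profile of `D` in the variances: minimizing over the mean is achieved at `μ`. -/
def IsMeanProfile {n : ℕ} (D : Divergence n) (p : E n → ℝ) (μ : E n)
    (f : (Fin n → ℝ) → ℝ) : Prop :=
  ∀ ψ : Fin n → ℝ, (∀ i, 0 < ψ i) →
    D (factorizedDensity μ ψ) p = f ψ ∧ ∀ ν, f ψ ≤ D (factorizedDensity ν ψ) p

lemma posDef_diagonal {n : ℕ} {ψ : Fin n → ℝ} (h : ∀ i, 0 < ψ i) :
    (Matrix.diagonal ψ).PosDef := Matrix.PosDef.diagonal h

lemma inv_diagonal_of_pos {n : ℕ} {ψ : Fin n → ℝ} (h : ∀ i, 0 < ψ i) :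
    (Matrix.diagonal ψ)⁻¹ = Matrix.diagonal (fun i => (ψ i)⁻¹) := by
  apply Matrix.inv_eq_right_inv
  rw [Matrix.diagonal_mul_diagonal, ← Matrix.diagonal_one]
  congr 1
  ext i
  exact mul_inv_cancel₀ (h i).ne'

lemma dotProduct_mulVec_nonneg {n : ℕ} {A : Matrix (Fin n) (Fin n) ℝ} (hA : A.PosDef)
    (x : Fin n → ℝ) : 0 ≤ x ⬝ᵥ (A *ᵥ x) := by
  simpa using hA.posSemidef.dotProduct_mulVec_nonneg x

lemma dotProduct_mulVec_pos {n : ℕ} {A : Matrix (Fin n) (Fin n) ℝ} (hA : A.PosDef)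
    {x : Fin n → ℝ} (hx : x ≠ 0) : 0 < x ⬝ᵥ (A *ᵥ x) := by
  simpa using hA.dotProduct_mulVec_pos hx

lemma log_det_diagonal {n : ℕ} {ψ : Fin n → ℝ} (h : ∀ i, 0 < ψ i) :
    Real.log (Matrix.diagonal ψ).det = ∑ i, Real.log (ψ i) := by
  rw [Matrix.det_diagonal, Real.log_prod fun i _ => (h i).ne']

lemma isMeanProfile_klReverse {n : ℕ} (μ : E n) {C : Matrix (Fin n) (Fin n) ℝ} (hC : C.PosDef) :
    IsMeanProfile (klReverse n) (gaussianDensity μ C) μ fun ψ =>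
      (1 / 2) * (Real.log C.det - n + ∑ i, (C⁻¹ i i * ψ i - Real.log (ψ i))) := by
  intro ψ hψ
  have h : ∀ ν, klReverse n (factorizedDensity ν ψ) (gaussianDensity μ C) =
      (1 / 2) * (Real.log C.det - n + ∑ i, (C⁻¹ i i * ψ i - Real.log (ψ i))) +
        (1 / 2) * ((ν - μ).ofLp ⬝ᵥ (C⁻¹ *ᵥ (ν - μ).ofLp)) := by
    intro ν
    rw [klReverse, factorizedDensity, expect_log_gaussianDensity_div ν μ (posDef_diagonal hψ) hC,
      log_det_diagonal hψ, Finset.sum_sub_distrib]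
    have : (C⁻¹ * Matrix.diagonal ψ).trace = ∑ i, C⁻¹ i i * ψ i := by
      simp [Matrix.trace, Matrix.mul_diagonal]
    rw [this]
    ring
  refine ⟨by rw [h]; simp, fun ν => ?_⟩
  rw [h]
  have := dotProduct_mulVec_nonneg hC.inv (ν - μ).ofLp
  linarith

lemma isMeanProfile_klForward {n : ℕ} (μ : E n) {C : Matrix (Fin n) (Fin n) ℝ} (hC : C.PosDef) :
    IsMeanProfile (klForward n) (gaussianDensity μ C) μ fun ψ =>
      (1 / 2) * (-Real.log C.det - n + ∑ i, (C i i * (ψ i)⁻¹ - Real.log (ψ i)⁻¹)) := by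
  intro ψ hψ
  have h : ∀ ν, klForward n (factorizedDensity ν ψ) (gaussianDensity μ C) =
      (1 / 2) * (-Real.log C.det - n + ∑ i, (C i i * (ψ i)⁻¹ - Real.log (ψ i)⁻¹)) +
        (1 / 2) * ((μ - ν).ofLp ⬝ᵥ ((Matrix.diagonal ψ)⁻¹ *ᵥ (μ - ν).ofLp)) := by
    intro ν
    rw [klForward, factorizedDensity, expect_log_gaussianDensity_div μ ν hC (posDef_diagonal hψ),
      log_det_diagonal hψ, Finset.sum_sub_distrib, inv_diagonal_of_pos hψ]
    have : (Matrix.diagonal (fun i => (ψ i)⁻¹) * C).trace = ∑ i, C i i * (ψ i)⁻¹ := by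
      simp [Matrix.trace, Matrix.diagonal_mul, mul_comm]
    rw [this]
    simp only [Real.log_inv, Finset.sum_neg_distrib]
    ring
  refine ⟨by rw [h]; simp, fun ν => ?_⟩
  rw [h]
  have := dotProduct_mulVec_nonneg (posDef_diagonal hψ).inv (μ - ν).ofLp
  linarith

/-- Serves both score divergences, since each weights by the covariance `A` of the distribution
under which the expectation is taken. -/
lemma expect_weightedNormSq_affine {n : ℕ} (m m' : E n) {A B : Matrix (Fin n) (Fin n) ℝ}
    (hA : A.PosDef) (hB : B.PosDef) :
    expect (gaussianDensity m A) (fun z =>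
      (B⁻¹ *ᵥ (z - m').ofLp - A⁻¹ *ᵥ (z - m).ofLp) ⬝ᵥ
        (A *ᵥ (B⁻¹ *ᵥ (z - m').ofLp - A⁻¹ *ᵥ (z - m).ofLp))) =
      n - 2 * (B⁻¹ * A).trace + (B⁻¹ * A * (B⁻¹ * A)).trace +
        (B⁻¹ *ᵥ (m - m').ofLp) ⬝ᵥ (A *ᵥ (B⁻¹ *ᵥ (m - m').ofLp)) := by
  have h := expect_quadratic m hA (B⁻¹ - A⁻¹) A (B⁻¹ *ᵥ (m - m').ofLp)
  have e : ∀ z : E n, (B⁻¹ - A⁻¹) *ᵥ (z - m).ofLp + B⁻¹ *ᵥ (m - m').ofLp =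
      B⁻¹ *ᵥ (z - m').ofLp - A⁻¹ *ᵥ (z - m).ofLp := by
    intro z
    have : (z - m').ofLp = (z - m).ofLp + (m - m').ofLp := by
      rw [← WithLp.ofLp_add, sub_add_sub_cancel]
    rw [this, Matrix.sub_mulVec, Matrix.mulVec_add]
    abel
  simp only [e] at h
  rw [h]
  congr 1
  have hs : (B⁻¹ - A⁻¹)ᵀ = B⁻¹ - A⁻¹ := by
    have h1 := (hB.inv.isHermitian.sub hA.inv.isHermitian).eq
    simpa using h1
  rw [hs]
  have hAi : A⁻¹ * A = 1 := Matrix.nonsing_inv_mul _ hA.det_pos.ne'.isUnit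
  have : (B⁻¹ - A⁻¹) * A * (B⁻¹ - A⁻¹) * A =
      B⁻¹ * A * (B⁻¹ * A) - B⁻¹ * A - B⁻¹ * A + 1 := by
    rw [mul_assoc ((B⁻¹ - A⁻¹) * A), sub_mul, hAi]
    noncomm_ring
  rw [this]
  simp
  ring

lemma isMeanProfile_scoreReverse {n : ℕ} (μ : E n) {C : Matrix (Fin n) (Fin n) ℝ}
    (hC : C.PosDef) :
    IsMeanProfile (scoreReverse n) (gaussianDensity μ C) μ (scoreQuadratic C⁻¹) := by
  intro ψ hψ
  have hD := posDef_diagonal hψ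
  have h : ∀ ν, scoreReverse n (factorizedDensity ν ψ) (gaussianDensity μ C) =
      scoreQuadratic C⁻¹ ψ + (C⁻¹ *ᵥ (ν - μ).ofLp) ⬝ᵥ
        (Matrix.diagonal ψ *ᵥ (C⁻¹ *ᵥ (ν - μ).ofLp)) := by
    intro ν
    simp only [scoreReverse, factorizedDensity, weightedNormSq, cov_gaussianDensity ν hD,
      gradient_log_gaussianDensity_div ν μ hD hC]
    rw [expect_weightedNormSq_affine ν μ hD hC, scoreQuadratic]
    congr 2
    · simp [Matrix.trace, Matrix.mul_diagonal]
    · simp only [Matrix.trace, Matrix.diag, Matrix.mul_apply (M := C⁻¹ * Matrix.diagonal ψ),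
        Matrix.mul_diagonal]
      refine Finset.sum_congr rfl fun i _ => Finset.sum_congr rfl fun j _ => ?_
      have : C⁻¹ j i = C⁻¹ i j := by simpa using hC.inv.isHermitian.apply i j
      rw [this]
      ring
  refine ⟨by rw [h]; simp, fun ν => ?_⟩
  rw [h]
  have := dotProduct_mulVec_nonneg hD (C⁻¹ *ᵥ (ν - μ).ofLp)
  linarith

lemma isMeanProfile_scoreForward {n : ℕ} (μ : E n) {C : Matrix (Fin n) (Fin n) ℝ}
    (hC : C.PosDef) :
    IsMeanProfile (scoreForward n) (gaussianDensity μ C) μ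
      (fun ψ => scoreQuadratic C fun i => (ψ i)⁻¹) := by
  intro ψ hψ
  have hD := posDef_diagonal hψ
  have h : ∀ ν, scoreForward n (factorizedDensity ν ψ) (gaussianDensity μ C) =
      (scoreQuadratic C fun i => (ψ i)⁻¹) + ((Matrix.diagonal ψ)⁻¹ *ᵥ (μ - ν).ofLp) ⬝ᵥ
        (C *ᵥ ((Matrix.diagonal ψ)⁻¹ *ᵥ (μ - ν).ofLp)) := by
    intro ν
    -- Here the expectation is under `p` while the gradient is that of `log (q / p)`, so its sign is
    -- opposite to the one in the common formula.
    have hneg : ∀ a b : Fin n → ℝ, (a - b) ⬝ᵥ (C *ᵥ (a - b)) = (b - a) ⬝ᵥ (C *ᵥ (b - a)) := by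
      intro a b
      rw [← neg_sub b a, Matrix.mulVec_neg, neg_dotProduct_neg]
    simp only [scoreForward, factorizedDensity, weightedNormSq, cov_gaussianDensity μ hC,
      gradient_log_gaussianDensity_div ν μ hD hC]
    simp only [hneg (C⁻¹ *ᵥ _)]
    rw [expect_weightedNormSq_affine μ ν hC hD, scoreQuadratic]
    congr 2
    · simp [Matrix.trace, inv_diagonal_of_pos hψ, Matrix.diagonal_mul, mul_comm]
    · simp only [Matrix.trace, Matrix.diag, inv_diagonal_of_pos hψ,
        Matrix.mul_apply (M := Matrix.diagonal _ * C), Matrix.diagonal_mul]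
      refine Finset.sum_congr rfl fun i _ => Finset.sum_congr rfl fun j _ => ?_
      have : C j i = C i j := by simpa using hC.isHermitian.apply i j
      rw [this]
      ring
  refine ⟨by rw [h]; simp, fun ν => ?_⟩
  rw [h]
  have := dotProduct_mulVec_nonneg hC ((Matrix.diagonal ψ)⁻¹ *ᵥ (μ - ν).ofLp)
  linarith

/-- The matrix `α Ψ + (1 - α) C` for the diagonal matrix `Ψ` with entries `ψ`. -/
def interpolant {n : ℕ} (C : Matrix (Fin n) (Fin n) ℝ) (α : ℝ) (ψ : Fin n → ℝ) :
    Matrix (Fin n) (Fin n) ℝ := α • Matrix.diagonal ψ + (1 - α) • C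

lemma posDef_interpolant {n : ℕ} {C : Matrix (Fin n) (Fin n) ℝ} (hC : C.PosDef) {α : ℝ}
    (h0 : 0 < α) (h1 : α < 1) {ψ : Fin n → ℝ} (hψ : ∀ i, 0 < ψ i) :
    (interpolant C α ψ).PosDef :=
  ((posDef_diagonal hψ).smul h0).add (hC.smul (sub_pos.2 h1))

/-- Up to constants, minus twice the logarithm of `∫ p ^ α q ^ (1 - α)` for equal means. -/
noncomputable def renyiPotential {n : ℕ} (C : Matrix (Fin n) (Fin n) ℝ) (α : ℝ)
    (ψ : Fin n → ℝ) : ℝ :=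
  Real.log (interpolant C α ψ).det - α * ∑ i, Real.log (ψ i)

lemma rpow_gaussianDensity_mul {n : ℕ} (μ ν : E n) {C D : Matrix (Fin n) (Fin n) ℝ}
    (hC : C.PosDef) (hD : D.PosDef) (α : ℝ) (z : E n) :
    gaussianDensity ν D z * (gaussianDensity μ C z ^ α / gaussianDensity ν D z ^ α) =
      Real.exp (-(1 / 2) * (Real.log ((2 * Real.pi) ^ n) + α * Real.log C.det +
        (1 - α) * Real.log D.det)) *
      Real.exp (-(1 / 2) * (α * ((z - μ).ofLp ⬝ᵥ (C⁻¹ *ᵥ (z - μ).ofLp)) +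
        (1 - α) * ((z - ν).ofLp ⬝ᵥ (D⁻¹ *ᵥ (z - ν).ofLp)))) := by
  have hp := gaussianDensity_pos μ hC z
  have hq := gaussianDensity_pos ν hD z
  rw [Real.rpow_def_of_pos hp, Real.rpow_def_of_pos hq, ← Real.exp_sub]
  nth_rewrite 1 [← Real.exp_log hq]
  rw [← Real.exp_add, ← Real.exp_add, log_gaussianDensity μ hC, log_gaussianDensity ν hD]
  congr 1
  ring

lemma dotProduct_mulVec_add {n : ℕ} {A : Matrix (Fin n) (Fin n) ℝ} (hA : A.IsHermitian)
    (y u : Fin n → ℝ) :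
    (y + u) ⬝ᵥ (A *ᵥ (y + u)) = y ⬝ᵥ (A *ᵥ y) + 2 * (y ⬝ᵥ (A *ᵥ u)) + u ⬝ᵥ (A *ᵥ u) := by
  have hs : u ⬝ᵥ (A *ᵥ y) = y ⬝ᵥ (A *ᵥ u) := by
    have hA' : Aᵀ = A := by simpa using hA.eq
    rw [Matrix.dotProduct_mulVec, ← Matrix.mulVec_transpose, hA', dotProduct_comm]
  rw [Matrix.mulVec_add, add_dotProduct, dotProduct_add, dotProduct_add, hs]
  ring

/-- Completing the square for a sum of two quadratic forms. -/
lemma exists_add_quadratic_eq {n : ℕ} (μ ν : E n) {A B : Matrix (Fin n) (Fin n) ℝ}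
    (hA : A.PosDef) (hB : B.PosDef) :
    ∃ (c : E n) (r : ℝ), 0 ≤ r ∧ (μ = ν → r = 0) ∧ ∀ z : E n,
      (z - μ).ofLp ⬝ᵥ (A *ᵥ (z - μ).ofLp) + (z - ν).ofLp ⬝ᵥ (B *ᵥ (z - ν).ofLp) =
        (z - c).ofLp ⬝ᵥ ((A + B) *ᵥ (z - c).ofLp) + r := by
  have hAB := hA.add hB
  set c : E n := WithLp.toLp 2 ((A + B)⁻¹ *ᵥ (A *ᵥ μ.ofLp + B *ᵥ ν.ofLp)) with hc
  have hcc : (A + B) *ᵥ c.ofLp = A *ᵥ μ.ofLp + B *ᵥ ν.ofLp := by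
    simp only [hc, Matrix.mulVec_mulVec]
    rw [Matrix.mul_nonsing_inv _ hAB.det_pos.ne'.isUnit, Matrix.one_mulVec]
  refine ⟨c, (c - μ).ofLp ⬝ᵥ (A *ᵥ (c - μ).ofLp) + (c - ν).ofLp ⬝ᵥ (B *ᵥ (c - ν).ofLp),
    add_nonneg (dotProduct_mulVec_nonneg hA _) (dotProduct_mulVec_nonneg hB _), ?_, fun z => ?_⟩
  · rintro rfl
    have : c.ofLp = μ.ofLp := by
      simp only [hc]
      rw [← Matrix.add_mulVec, Matrix.mulVec_mulVec,
        Matrix.nonsing_inv_mul _ hAB.det_pos.ne'.isUnit, Matrix.one_mulVec]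
    simp [this]
  · have e1 : (z - μ).ofLp = (z - c).ofLp + (c - μ).ofLp := by
      rw [← WithLp.ofLp_add, sub_add_sub_cancel]
    have e2 : (z - ν).ofLp = (z - c).ofLp + (c - ν).ofLp := by
      rw [← WithLp.ofLp_add, sub_add_sub_cancel]
    rw [e1, e2, dotProduct_mulVec_add hA.isHermitian, dotProduct_mulVec_add hB.isHermitian,
      Matrix.add_mulVec, dotProduct_add]
    have hx : A *ᵥ (c - μ).ofLp + B *ᵥ (c - ν).ofLp = 0 := by
      rw [WithLp.ofLp_sub, WithLp.ofLp_sub, Matrix.mulVec_sub, Matrix.mulVec_sub]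
      rw [Matrix.add_mulVec] at hcc
      have : A *ᵥ c.ofLp - A *ᵥ μ.ofLp + (B *ᵥ c.ofLp - B *ᵥ ν.ofLp) =
        (A *ᵥ c.ofLp + B *ᵥ c.ofLp) - (A *ᵥ μ.ofLp + B *ᵥ ν.ofLp) := by abel
      rw [this, hcc, sub_self]
    have hx2 := congrArg (fun v => (z - c).ofLp ⬝ᵥ v) hx
    simp only [dotProduct_add, dotProduct_zero] at hx2
    linarith

lemma det_interpolation_precision {n : ℕ} {C : Matrix (Fin n) (Fin n) ℝ} (hC : C.PosDef)
    {α : ℝ} {ψ : Fin n → ℝ} (hψ : ∀ i, 0 < ψ i) :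
    (α • C⁻¹ + (1 - α) • (Matrix.diagonal ψ)⁻¹).det =
      (interpolant C α ψ).det / (C.det * (Matrix.diagonal ψ).det) := by
  have hD := posDef_diagonal hψ
  -- This factorization trades the mixture of precisions for the mixture of covariances.
  have e : α • C⁻¹ + (1 - α) • (Matrix.diagonal ψ)⁻¹ =
      C⁻¹ * interpolant C α ψ * (Matrix.diagonal ψ)⁻¹ := by
    simp only [interpolant, mul_add, add_mul, Matrix.mul_smul, Matrix.smul_mul]
    rw [Matrix.nonsing_inv_mul _ hC.det_pos.ne'.isUnit, mul_assoc,
      Matrix.mul_nonsing_inv _ hD.det_pos.ne'.isUnit, mul_one, one_mul]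
  rw [e, Matrix.det_mul, Matrix.det_mul, Matrix.det_nonsing_inv, Matrix.det_nonsing_inv,
    Ring.inverse_eq_inv']
  have := hC.det_pos
  have := hD.det_pos
  field_simp

/-- Completing the square, `p ^ α q ^ (1 - α)` is a Gaussian kernel times `exp (-r / 2)`, where `r ≥
0` measures the mismatch of the means. As `1 / (α (α - 1)) < 0`, a mismatch can only raise the
divergence. -/
lemma isMeanProfile_renyi {n : ℕ} (μ : E n) {C : Matrix (Fin n) (Fin n) ℝ}
    (hC : C.PosDef) {α : ℝ} (h0 : 0 < α) (h1 : α < 1) :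
    IsMeanProfile (renyi n α) (gaussianDensity μ C) μ (fun ψ =>
      1 / (α * (α - 1)) * (Real.exp (-(1 / 2) * (renyiPotential C α ψ -
        (1 - α) * Real.log C.det)) - 1)) := by
  intro ψ hψ
  have hD := posDef_diagonal hψ
  have hM := posDef_interpolant hC h0 h1 hψ
  have hCd := hC.det_pos
  have hDd := hD.det_pos
  have hMd := hM.det_pos
  set V := Real.exp (-(1 / 2) * (renyiPotential C α ψ - (1 - α) * Real.log C.det)) with hV
  have h : ∀ ν, ∃ r : ℝ, 0 ≤ r ∧ (μ = ν → r = 0) ∧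
      renyi n α (factorizedDensity ν ψ) (gaussianDensity μ C) =
        1 / (α * (α - 1)) * (V * Real.exp (-(1 / 2) * r) - 1) := by
    intro ν
    have hP1 := hC.inv.smul h0
    have hP2 := hD.inv.smul (sub_pos.2 h1)
    obtain ⟨c, r, hr, hr0, hz⟩ := exists_add_quadratic_eq μ ν hP1 hP2
    refine ⟨r, hr, hr0, ?_⟩
    have hP := hP1.add hP2
    set P := α • C⁻¹ + (1 - α) • (Matrix.diagonal ψ)⁻¹ with hPdef
    set K := Real.exp (-(1 / 2) * (Real.log ((2 * Real.pi) ^ n) + α * Real.log C.det +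
        (1 - α) * Real.log (Matrix.diagonal ψ).det)) with hK
    have hpt : ∀ z : E n, gaussianDensity ν (Matrix.diagonal ψ) z *
        (gaussianDensity μ C z ^ α / gaussianDensity ν (Matrix.diagonal ψ) z ^ α - 1) =
        K * Real.exp (-(1 / 2) * r) *
          Real.exp (-(1 / 2) * ((z - c).ofLp ⬝ᵥ (P *ᵥ (z - c).ofLp))) -
          gaussianDensity ν (Matrix.diagonal ψ) z := by
      intro z
      rw [mul_sub, rpow_gaussianDensity_mul μ ν hC hD, mul_one, hK]
      have := hz z
      simp only [Matrix.smul_mulVec, dotProduct_smul, smul_eq_mul] at this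
      rw [this, ← Real.exp_add, ← Real.exp_add, ← Real.exp_add]
      congr 2
      ring
    simp only [renyi, factorizedDensity, expect, hpt]
    rw [integral_sub ((integrable_exp_neg_quadratic c hP).const_mul _)
      (integrable_gaussianDensity ν hD), integral_const_mul, integral_exp_neg_quadratic c hP,
      integral_gaussianDensity ν hD]
    congr 2
    rw [mul_right_comm]
    congr 1
    have hPd := hP.det_pos
    have hpi : (0 : ℝ) < (2 * Real.pi) ^ n := by positivity
    have : Real.sqrt ((2 * Real.pi) ^ n / P.det) =
        Real.exp ((1 / 2) * (Real.log ((2 * Real.pi) ^ n) - Real.log P.det)) := by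
      rw [← Real.log_div hpi.ne' hPd.ne', ← Real.exp_log (show 0 < √((2 * Real.pi) ^ n / P.det) by
        positivity), Real.log_sqrt (by positivity)]
      congr 1
      ring
    rw [this, hK, ← Real.exp_add, hV, hPdef, det_interpolation_precision hC hψ,
      Real.log_div hMd.ne' (by positivity), Real.log_mul hCd.ne' hDd.ne', log_det_diagonal hψ,
      renyiPotential]
    congr 1
    ring
  have hneg : 1 / (α * (α - 1)) < 0 := by
    apply div_neg_of_pos_of_neg one_pos
    exact mul_neg_of_pos_of_neg h0 (by linarith)
  constructor
  · obtain ⟨r, _, hr0, hr⟩ := h μ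
    rw [hr, hr0 rfl, mul_zero, Real.exp_zero, mul_one]
  · intro ν
    obtain ⟨r, hr0, _, hr⟩ := h ν
    rw [hr]
    apply mul_le_mul_of_nonpos_left _ hneg.le
    have h1 : Real.exp (-(1 / 2) * r) ≤ 1 := Real.exp_le_one_iff.2 (by linarith)
    have h2 : 0 < V := Real.exp_pos _
    nlinarith

/-! ### Diagonal entries of inverse matrices. -/

lemma inv_apply_self_eq {n : ℕ} {A : Matrix (Fin n) (Fin n) ℝ} (hA : A.PosDef)
    {u : Fin n → ℝ} {i : Fin n} (hu : A *ᵥ u = Pi.single i 1) : A⁻¹ i i = u i := by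
  have : u = A⁻¹ *ᵥ Pi.single i 1 := by
    rw [← hu, Matrix.mulVec_mulVec, Matrix.nonsing_inv_mul _ hA.det_pos.ne'.isUnit,
      Matrix.one_mulVec]
  rw [this]
  simp

lemma mulVec_inv_mulVec_single {n : ℕ} {A : Matrix (Fin n) (Fin n) ℝ} (hA : A.PosDef)
    (i : Fin n) : A *ᵥ (A⁻¹ *ᵥ Pi.single i 1) = Pi.single i 1 := by
  rw [Matrix.mulVec_mulVec, Matrix.mul_nonsing_inv _ hA.det_pos.ne'.isUnit, Matrix.one_mulVec]

/-- The variational characterization of the diagonal of the inverse. -/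
lemma two_mul_sub_le_inv {n : ℕ} {A : Matrix (Fin n) (Fin n) ℝ} (hA : A.PosDef)
    (x : Fin n → ℝ) (i : Fin n) :
    2 * x i - x ⬝ᵥ (A *ᵥ x) ≤ A⁻¹ i i ∧
      (2 * x i - x ⬝ᵥ (A *ᵥ x) = A⁻¹ i i → A *ᵥ x = Pi.single i 1) := by
  set u := A⁻¹ *ᵥ Pi.single i 1
  have hu : A *ᵥ u = Pi.single i 1 := mulVec_inv_mulVec_single hA i
  have hii := inv_apply_self_eq hA hu
  have key : A⁻¹ i i - (2 * x i - x ⬝ᵥ (A *ᵥ x)) = (x - u) ⬝ᵥ (A *ᵥ (x - u)) := by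
    rw [sub_eq_add_neg x u, dotProduct_mulVec_add hA.isHermitian, Matrix.mulVec_neg,
      neg_dotProduct_neg, dotProduct_neg, hu, hii]
    simp
    ring
  refine ⟨by linarith [dotProduct_mulVec_nonneg hA (x - u)], fun h => ?_⟩
  by_cases hxu : x - u = 0
  · rw [sub_eq_zero.1 hxu, hu]
  · linarith [dotProduct_mulVec_pos hA hxu]

lemma inv_apply_self_eq_two_mul_sub {n : ℕ} {A : Matrix (Fin n) (Fin n) ℝ} (hA : A.PosDef)
    {u : Fin n → ℝ} {i : Fin n} (hu : A *ᵥ u = Pi.single i 1) :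
    A⁻¹ i i = 2 * u i - u ⬝ᵥ (A *ᵥ u) := by
  rw [inv_apply_self_eq hA hu, hu]
  simp
  ring

/-- Convexity of the diagonal entries of the inverse. -/
lemma inv_apply_self_convex {n : ℕ} {A B : Matrix (Fin n) (Fin n) ℝ} (hA : A.PosDef)
    (hB : B.PosDef) {θ : ℝ} (h0 : 0 < θ) (h1 : θ < 1) (i : Fin n) :
    (θ • A + (1 - θ) • B)⁻¹ i i ≤ θ * A⁻¹ i i + (1 - θ) * B⁻¹ i i ∧
      ((θ • A + (1 - θ) • B)⁻¹ i i = θ * A⁻¹ i i + (1 - θ) * B⁻¹ i i →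
        ∃ u, A *ᵥ u = Pi.single i 1 ∧ B *ᵥ u = Pi.single i 1) := by
  have hM := (hA.smul h0).add (hB.smul (sub_pos.2 h1))
  have hu := mulVec_inv_mulVec_single hM i
  set u := (θ • A + (1 - θ) • B)⁻¹ *ᵥ Pi.single i 1
  -- The maximizer `u` for the mixture is a test vector for both `A` and `B`; equality makes it
  -- optimal for both.
  rw [inv_apply_self_eq_two_mul_sub hM hu]
  have e : u ⬝ᵥ ((θ • A + (1 - θ) • B) *ᵥ u) =
      θ * (u ⬝ᵥ (A *ᵥ u)) + (1 - θ) * (u ⬝ᵥ (B *ᵥ u)) := by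
    simp [Matrix.add_mulVec, Matrix.smul_mulVec]
  obtain ⟨a1, a2⟩ := two_mul_sub_le_inv hA u i
  obtain ⟨b1, b2⟩ := two_mul_sub_le_inv hB u i
  have h1' : 0 < 1 - θ := sub_pos.2 h1
  rw [e]
  refine ⟨by nlinarith, fun h => ⟨u, a2 ?_, b2 ?_⟩⟩
  · by_contra hne
    have := lt_of_le_of_ne a1 hne
    nlinarith
  · by_contra hne
    have := lt_of_le_of_ne b1 hne
    nlinarith

/-- The common equality case: `Ψ u = e_i` forces `u` to be supported at `i`, and then row `i` of `C
u = e_i` reads `C i i * u i = 1`. -/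
lemma mul_inv_apply_self_eq_one {n : ℕ} {C : Matrix (Fin n) (Fin n) ℝ} (hC : C.PosDef)
    {ψ : Fin n → ℝ} (hψ : ∀ i, 0 < ψ i) {u : Fin n → ℝ} {i : Fin n}
    (h1 : Matrix.diagonal ψ *ᵥ u = Pi.single i 1) (h2 : C *ᵥ u = Pi.single i 1) :
    C i i * C⁻¹ i i = 1 := by
  rw [inv_apply_self_eq hC h2]
  have hu : ∀ j, j ≠ i → u j = 0 := fun j hj => by
    have := congrFun h1 j
    simp only [Matrix.mulVec_diagonal, Pi.single_eq_of_ne hj] at this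
    exact (mul_eq_zero.1 this).resolve_left (hψ j).ne'
  have := congrFun h2 i
  simp only [Matrix.mulVec, dotProduct, Pi.single_eq_same] at this
  rwa [Finset.sum_eq_single i (fun j _ hj => by rw [hu j hj, mul_zero]) (by simp)] at this

/-- Test the variational formula with `e_i / C i i`; if this vector is optimal, column `i` of `C` is
a multiple of `e_i`. -/
lemma one_le_mul_inv_apply_self {n : ℕ} {C : Matrix (Fin n) (Fin n) ℝ} (hC : C.PosDef)
    (i : Fin n) : 1 ≤ C i i * C⁻¹ i i ∧ (C i i * C⁻¹ i i = 1 → ∀ j, j ≠ i → C j i = 0) := by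
  have hii : 0 < C i i := hC.diag_pos
  obtain ⟨h1, h2⟩ := two_mul_sub_le_inv hC (Pi.single i (C i i)⁻¹) i
  have e : 2 * (Pi.single i (C i i)⁻¹ : Fin n → ℝ) i - (Pi.single i (C i i)⁻¹) ⬝ᵥ
      (C *ᵥ Pi.single i (C i i)⁻¹) = (C i i)⁻¹ := by
    simp
    field_simp
    ring
  rw [e] at h1 h2
  refine ⟨?_, fun h j hj => ?_⟩
  · rwa [inv_le_iff_one_le_mul₀' hii] at h1
  · have := congrFun (h2 (by field_simp; linarith)) j
    simp only [Matrix.mulVec_single, Pi.single_eq_of_ne hj] at this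
    simpa [hii.ne'] using this

lemma exists_one_lt_mul_inv {n : ℕ} {C : Matrix (Fin n) (Fin n) ℝ} (hC : C.PosDef)
    (hd : ¬ C.IsDiag) : ∃ i, 1 < C i i * C⁻¹ i i := by
  by_contra! h
  apply hd
  intro j i hij
  obtain ⟨h1, h2⟩ := one_le_mul_inv_apply_self hC i
  exact h2 (le_antisymm (h i) h1) j hij

/-! ### The Rényi stationarity equations: bounds, comparison and lower estimates. -/

lemma dotProduct_interpolant_mulVec {n : ℕ} (C : Matrix (Fin n) (Fin n) ℝ) (α : ℝ)
    (ψ x : Fin n → ℝ) :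
    x ⬝ᵥ (interpolant C α ψ *ᵥ x) = α * ∑ j, ψ j * x j ^ 2 + (1 - α) * (x ⬝ᵥ (C *ᵥ x)) := by
  simp only [interpolant, Matrix.add_mulVec, Matrix.smul_mulVec, dotProduct_add, dotProduct_smul,
    smul_eq_mul]
  congr 2
  simp only [dotProduct, Matrix.mulVec_diagonal]
  exact Finset.sum_congr rfl fun j _ => by ring

/-- The first-order optimality condition for `renyiPotential`. -/
def IsRenyiStationary {n : ℕ} (C : Matrix (Fin n) (Fin n) ℝ) (α : ℝ) (ψ : Fin n → ℝ) : Prop :=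
  ∀ i, ψ i * (interpolant C α ψ)⁻¹ i i = 1

section stationary

variable {n : ℕ} {C : Matrix (Fin n) (Fin n) ℝ} {α β : ℝ} {ψ φ : Fin n → ℝ}

/-- The matrix at `β` is a convex combination of the matrix at `α` and `Ψ`, and by stationarity both
have `1 / ψ i` as the `i`-th diagonal entry of the inverse. Convexity makes `ψ` a subsolution at
`β`. -/
lemma mul_inv_interpolant_le_one (hC : C.PosDef)
    (h0 : 0 < α) (hαβ : α < β) (h1 : β < 1) (hψ : ∀ i, 0 < ψ i)
    (hs : IsRenyiStationary C α ψ) (i : Fin n) :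
    ψ i * (interpolant C β ψ)⁻¹ i i ≤ 1 ∧
      (1 < C i i * C⁻¹ i i → ψ i * (interpolant C β ψ)⁻¹ i i < 1) := by
  have hα1 : 0 < 1 - α := by linarith
  -- The weight that matches the coefficients of `C`.
  set θ := (1 - β) / (1 - α) with hθ
  have hθm : θ * (1 - α) = 1 - β := by rw [hθ]; field_simp
  have hθ0 : 0 < θ := div_pos (by linarith) hα1
  have hθ1 : θ < 1 := by rw [hθ, div_lt_one hα1]; linarith
  have hA := posDef_interpolant hC h0 (hαβ.trans h1) hψ
  have hD := posDef_diagonal hψ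
  have e : interpolant C β ψ = θ • interpolant C α ψ + (1 - θ) • Matrix.diagonal ψ := by
    have hβ : β = θ * α + (1 - θ) := by linarith
    simp only [interpolant, smul_add, smul_smul, hθm]
    nth_rewrite 1 [hβ]
    rw [add_smul]
    abel
  obtain ⟨c1, c2⟩ := inv_apply_self_convex hA hD hθ0 hθ1 i
  rw [← e, inv_diagonal_of_pos hψ, Matrix.diagonal_apply_eq] at c1 c2
  have hi := hψ i
  have hsi : (interpolant C α ψ)⁻¹ i i = (ψ i)⁻¹ := eq_inv_of_mul_eq_one_right (hs i)
  have hr : θ * (interpolant C α ψ)⁻¹ i i + (1 - θ) * (ψ i)⁻¹ = (ψ i)⁻¹ := by rw [hsi]; ring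
  rw [hr] at c1 c2
  have hle : ψ i * (interpolant C β ψ)⁻¹ i i ≤ 1 := by
    rwa [← le_inv_mul_iff₀ hi, mul_one]
  refine ⟨hle, fun hn => lt_of_le_of_ne hle fun heq => ?_⟩
  obtain ⟨u, hu1, hu2⟩ := c2 (eq_inv_of_mul_eq_one_right heq)
  have : C *ᵥ u = Pi.single i 1 := by
    rw [interpolant, Matrix.add_mulVec, Matrix.smul_mulVec, hu2, Matrix.smul_mulVec] at hu1
    have h3 : (1 - α) • (C *ᵥ u) = (1 - α) • (Pi.single i 1 : Fin n → ℝ) := by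
      rw [eq_sub_of_add_eq' hu1, sub_smul, one_smul]
    exact smul_right_injective _ hα1.ne' h3
  exact hn.ne' (mul_inv_apply_self_eq_one hC hψ hu2 this)

/-- Convexity between `Ψ` and `C` reads `1 / ψ i ≤ α / ψ i + (1 - α) * C⁻¹ i i`. -/
lemma inv_inv_le_of_isRenyiStationary (hC : C.PosDef)
    (h0 : 0 < α) (h1 : α < 1) (hψ : ∀ i, 0 < ψ i)
    (hs : IsRenyiStationary C α ψ) (i : Fin n) :
    (C⁻¹ i i)⁻¹ ≤ ψ i ∧ (1 < C i i * C⁻¹ i i → (C⁻¹ i i)⁻¹ < ψ i) := by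
  obtain ⟨c1, c2⟩ := inv_apply_self_convex (posDef_diagonal hψ) hC h0 h1 i
  rw [← interpolant, inv_diagonal_of_pos hψ, Matrix.diagonal_apply_eq] at c1 c2
  have hi := hψ i
  have hΛ : 0 < C⁻¹ i i := hC.inv.diag_pos
  have hsi : (interpolant C α ψ)⁻¹ i i = (ψ i)⁻¹ := eq_inv_of_mul_eq_one_right (hs i)
  rw [hsi] at c1 c2
  have hle : (ψ i)⁻¹ ≤ C⁻¹ i i := by nlinarith
  refine ⟨inv_le_of_inv_le₀ hi hle, fun hn => inv_lt_of_inv_lt₀ hi (lt_of_le_of_ne hle ?_)⟩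
  intro heq
  obtain ⟨u, hu1, hu2⟩ := c2 (by rw [← heq]; ring)
  exact hn.ne' (mul_inv_apply_self_eq_one hC hψ hu1 hu2)

lemma le_apply_self_of_isRenyiStationary (hC : C.PosDef)
    (h0 : 0 < α) (h1 : α < 1) (hψ : ∀ i, 0 < ψ i)
    (hs : IsRenyiStationary C α ψ) (i : Fin n) :
    ψ i ≤ C i i ∧ (1 < C i i * C⁻¹ i i → ψ i < C i i) := by
  have hi := hψ i
  -- The maximizer of the variational formula for `Ψ`; against the interpolant it exceeds `1 / ψ i`
  -- by a positive multiple of `ψ i - C i i`.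
  set x : Fin n → ℝ := Pi.single i (ψ i)⁻¹ with hx
  obtain ⟨c1, c2⟩ := two_mul_sub_le_inv (posDef_interpolant hC h0 h1 hψ) x i
  have hsi : (interpolant C α ψ)⁻¹ i i = (ψ i)⁻¹ := eq_inv_of_mul_eq_one_right (hs i)
  have e : 2 * x i - x ⬝ᵥ (interpolant C α ψ *ᵥ x) =
      (ψ i)⁻¹ + (1 - α) * (ψ i)⁻¹ ^ 2 * (ψ i - C i i) := by
    rw [dotProduct_interpolant_mulVec, Finset.sum_eq_single i
      (fun j _ hj => by simp [hx, Pi.single_eq_of_ne hj]) (by simp)]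
    simp [hx]
    field_simp
    ring
  rw [e, hsi] at c1 c2
  have hpos : 0 < (1 - α) * (ψ i)⁻¹ ^ 2 := mul_pos (by linarith) (by positivity)
  have hle : ψ i ≤ C i i := by
    by_contra! hlt
    have := mul_pos hpos (sub_pos.2 hlt)
    linarith
  refine ⟨hle, fun hn => lt_of_le_of_ne hle fun heq => ?_⟩
  have hu := c2 (by rw [heq]; ring)
  have hu1 : Matrix.diagonal ψ *ᵥ x = Pi.single i 1 := by
    rw [hx, Matrix.diagonal_mulVec_single, mul_inv_cancel₀ hi.ne']
  have : C *ᵥ x = Pi.single i 1 := by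
    rw [interpolant, Matrix.add_mulVec, Matrix.smul_mulVec, hu1, Matrix.smul_mulVec] at hu
    have h3 : (1 - α) • (C *ᵥ x) = (1 - α) • (Pi.single i 1 : Fin n → ℝ) := by
      rw [eq_sub_of_add_eq' hu, sub_smul, one_smul]
    exact smul_right_injective _ (sub_pos.2 h1).ne' h3
  exact hn.ne' (mul_inv_apply_self_eq_one hC hψ hu1 this)

/-- Comparison principle: a subsolution of the stationarity equations lies below a solution. -/
lemma le_of_mul_inv_interpolant_le_one (hC : C.PosDef)
    (h0 : 0 < β) (h1 : β < 1) (hψ : ∀ i, 0 < ψ i)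
    (hφ : ∀ i, 0 < φ i) (hsub : ∀ i, ψ i * (interpolant C β ψ)⁻¹ i i ≤ 1)
    (hs : IsRenyiStationary C β φ) (i : Fin n) : ψ i ≤ φ i := by
  have : Nonempty (Fin n) := ⟨i⟩
  -- Compare where `ψ / φ` is largest: if the ratio `c` there exceeds `1`, then `ψ ≤ c φ` with
  -- equality at `k`.
  obtain ⟨k, hk⟩ := Finite.exists_max fun j => ψ j / φ j
  by_contra! hlt
  set c := ψ k / φ k with hc
  have hc1 : 1 < c := lt_of_lt_of_le ((one_lt_div (hφ i)).2 hlt) (hk i)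
  have hc0 : 0 < c := one_pos.trans hc1
  have hle : ∀ j, ψ j ≤ c * φ j := fun j => (div_le_iff₀ (hφ j)).1 (hk j)
  have hkc : ψ k = c * φ k := by rw [hc, div_mul_cancel₀ _ (hφ k).ne']
  have hB := posDef_interpolant hC h0 h1 hφ
  have hu := mulVec_inv_mulVec_single hB k
  set u := (interpolant C β φ)⁻¹ *ᵥ Pi.single k 1
  have hBk := inv_apply_self_eq_two_mul_sub hB hu
  have hune : u ≠ 0 := by
    intro h
    rw [h, Matrix.mulVec_zero] at hu
    simpa using congrFun hu k
  -- `c⁻¹ • u` is the maximizer for `c` times the matrix of `φ`.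
  have hAk := (two_mul_sub_le_inv (posDef_interpolant hC h0 h1 hψ) (c⁻¹ • u) k).1
  rw [Matrix.mulVec_smul, smul_dotProduct, dotProduct_smul, dotProduct_interpolant_mulVec] at hAk
  rw [dotProduct_interpolant_mulVec] at hBk
  simp only [Pi.smul_apply, smul_eq_mul] at hAk
  have hpos := dotProduct_mulVec_pos hC hune
  have hsum : ∑ j, ψ j * u j ^ 2 ≤ c * ∑ j, φ j * u j ^ 2 := by
    rw [Finset.mul_sum]
    refine Finset.sum_le_sum fun j _ => ?_
    rw [← mul_assoc]
    exact mul_le_mul_of_nonneg_right (hle j) (sq_nonneg _)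
  set a := (interpolant C β ψ)⁻¹ k k
  set b := (interpolant C β φ)⁻¹ k k
  set S := ∑ j, ψ j * u j ^ 2
  set T := ∑ j, φ j * u j ^ 2
  set q := u ⬝ᵥ (C *ᵥ u)
  have hφb : φ k * b = 1 := hs k
  have hψa : ψ k * a ≤ 1 := hsub k
  have hca : 2 * u k - c⁻¹ * (β * S + (1 - β) * q) ≤ c * a := by
    have := mul_le_mul_of_nonneg_left hAk hc0.le
    have e : c * (2 * (c⁻¹ * u k) - c⁻¹ * (c⁻¹ * (β * S + (1 - β) * q))) =
      2 * u k - c⁻¹ * (β * S + (1 - β) * q) := by field_simp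
    linarith
  -- Strict because the `C` part of the interpolant is not scaled up by `c > 1`.
  have h3 : c⁻¹ * (β * S + (1 - β) * q) < β * T + (1 - β) * q := by
    rw [inv_mul_lt_iff₀ hc0]
    have := mul_le_mul_of_nonneg_left hsum h0.le
    have := mul_pos (sub_pos.2 hc1) (mul_pos (sub_pos.2 h1) hpos)
    nlinarith
  have h4 : b < c * a := by linarith
  have := mul_lt_mul_of_pos_left h4 (hφ k)
  have e : φ k * (c * a) = ψ k * a := by rw [hkc]; ring
  linarith

/-- If `ψ i = φ i`, then `ψ ≤ φ` orders the inverses the other way, so `ψ i * (interpolant C β ψ)⁻¹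
i i` would be at least `1`. -/
lemma lt_of_mul_inv_interpolant_lt_one (hC : C.PosDef)
    (h0 : 0 < β) (h1 : β < 1) (hψ : ∀ i, 0 < ψ i)
    (hφ : ∀ i, 0 < φ i) (hsub : ∀ i, ψ i * (interpolant C β ψ)⁻¹ i i ≤ 1)
    (hs : IsRenyiStationary C β φ) {i : Fin n} (hi : ψ i * (interpolant C β ψ)⁻¹ i i < 1) :
    ψ i < φ i := by
  have hle := le_of_mul_inv_interpolant_le_one hC h0 h1 hψ hφ hsub hs
  refine lt_of_le_of_ne (hle i) fun heq => ?_
  have hB := posDef_interpolant hC h0 h1 hφ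
  have hu := mulVec_inv_mulVec_single hB i
  set u := (interpolant C β φ)⁻¹ *ᵥ Pi.single i 1
  have hBi := inv_apply_self_eq_two_mul_sub hB hu
  have hAi := (two_mul_sub_le_inv (posDef_interpolant hC h0 h1 hψ) u i).1
  rw [dotProduct_interpolant_mulVec] at hAi hBi
  have hsum : ∑ j, ψ j * u j ^ 2 ≤ ∑ j, φ j * u j ^ 2 :=
    Finset.sum_le_sum fun j _ => mul_le_mul_of_nonneg_right (hle j) (sq_nonneg _)
  have h3 := mul_le_mul_of_nonneg_left hsum h0.le
  have h4 : (interpolant C β φ)⁻¹ i i ≤ (interpolant C β ψ)⁻¹ i i := by linarith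
  have h5 := mul_le_mul_of_nonneg_left h4 (hψ i).le
  have h6 := hs i
  rw [← heq] at h6
  linarith

lemma isRenyiStationary_unique (hC : C.PosDef) (h0 : 0 < α) (h1 : α < 1) (hψ : ∀ i, 0 < ψ i)
    (hφ : ∀ i, 0 < φ i) (h : IsRenyiStationary C α ψ) (h' : IsRenyiStationary C α φ) : ψ = φ :=
  funext fun i => le_antisymm
    (le_of_mul_inv_interpolant_le_one hC h0 h1 hψ hφ (fun i => (h i).le) h' i)
    (le_of_mul_inv_interpolant_le_one hC h0 h1 hφ hψ (fun i => (h' i).le) h i)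

lemma isRenyiStationary_mono (hC : C.PosDef)
    (h0 : 0 < α) (hαβ : α < β) (h1 : β < 1) (hψ : ∀ i, 0 < ψ i)
    (hφ : ∀ i, 0 < φ i) (h : IsRenyiStationary C α ψ) (h' : IsRenyiStationary C β φ)
    (i : Fin n) : ψ i ≤ φ i ∧ (1 < C i i * C⁻¹ i i → ψ i < φ i) := by
  have hsub := mul_inv_interpolant_le_one hC h0 hαβ h1 hψ h
  exact ⟨le_of_mul_inv_interpolant_le_one hC (h0.trans hαβ) h1 hψ hφ (fun i => (hsub i).1) h' i,
    fun hi => lt_of_mul_inv_interpolant_lt_one hC (h0.trans hαβ) h1 hψ hφ (fun i => (hsub i).1) h'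
      ((hsub i).2 hi)⟩

/-- Matrix determinant lemma for a rank-one change; it makes the determinant affine in each
variance, so partial derivatives of the potential can be read off. -/
lemma det_interpolant_update (hC : C.PosDef)
    (h0 : 0 < α) (h1 : α < 1) (hψ : ∀ i, 0 < ψ i) (i : Fin n) (x : ℝ) :
    (interpolant C α (Function.update ψ i x)).det =
      (interpolant C α ψ).det * (1 + α * (x - ψ i) * (interpolant C α ψ)⁻¹ i i) := by
  have hA := posDef_interpolant hC h0 h1 hψ
  have e : interpolant C α (Function.update ψ i x) = interpolant C α ψ +
      Matrix.replicateCol Unit (Pi.single i (α * (x - ψ i))) *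
        Matrix.replicateRow Unit (Pi.single i (1 : ℝ)) := by
    ext j k
    simp only [interpolant, Matrix.add_apply, Matrix.smul_apply, Matrix.mul_apply,
      Matrix.replicateCol_apply, Matrix.replicateRow_apply, Matrix.diagonal_apply,
      Finset.univ_unique, Finset.sum_singleton, smul_eq_mul]
    by_cases hj : j = i
    · subst hj
      by_cases hk : j = k
      · subst hk; simp; ring
      · simp [hk, Ne.symm hk]
    · simp [hj]
  rw [e, Matrix.det_add_replicateCol_mul_replicateRow hA.det_pos.ne'.isUnit]
  congr 1
  rw [Matrix.det_unique]
  simp [Matrix.mul_apply, Pi.single_apply]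
  ring

lemma isRenyiStationary_of_isMin (hC : C.PosDef) (h0 : 0 < α) (h1 : α < 1) (hψ : ∀ i, 0 < ψ i)
    (hmin : ∀ φ : Fin n → ℝ, (∀ i, 0 < φ i) → renyiPotential C α ψ ≤ renyiPotential C α φ) :
    IsRenyiStationary C α ψ := by
  intro i
  have hi := hψ i
  have hA := posDef_interpolant hC h0 h1 hψ
  set a := (interpolant C α ψ)⁻¹ i i
  set g : ℝ → ℝ := fun x => Real.log ((interpolant C α ψ).det * (1 + α * (x - ψ i) * a)) -
    α * (∑ j ∈ Finset.univ.erase i, Real.log (ψ j) + Real.log x) with hg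
  have hge : ∀ x, g x = renyiPotential C α (Function.update ψ i x) := by
    intro x
    rw [renyiPotential, det_interpolant_update hC h0 h1 hψ,
      ← Finset.sum_erase_add _ _ (Finset.mem_univ i)]
    simp only [Function.update_self, hg]
    congr 3
    exact Finset.sum_congr rfl fun j hj => by
      rw [Function.update_of_ne (Finset.ne_of_mem_erase hj)]
  have hloc : IsLocalMin g (ψ i) := by
    filter_upwards [lt_mem_nhds hi] with x hx
    rw [hge, hge, Function.update_eq_self]
    refine hmin _ fun j => ?_
    by_cases hj : j = i
    · subst hj; simpa
    · rw [Function.update_of_ne hj]; exact hψ j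
  have hd : HasDerivAt g (α * a - α * (ψ i)⁻¹) (ψ i) := by
    have d1 : HasDerivAt (fun x => (interpolant C α ψ).det * (1 + α * (x - ψ i) * a))
        ((interpolant C α ψ).det * (α * 1 * a)) (ψ i) :=
      (((((hasDerivAt_id (ψ i)).sub_const (ψ i)).const_mul α).mul_const a).const_add 1).const_mul _
    have d2 := d1.log (by simpa using hA.det_pos.ne')
    have d3 := (((Real.hasDerivAt_log hi.ne').const_add
      (∑ j ∈ Finset.univ.erase i, Real.log (ψ j))).const_mul α)
    convert! d2.sub d3 using 1
    have := hA.det_pos.ne'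
    simp
    field_simp
  have := hloc.hasDerivAt_eq_zero hd
  have h2 : a = (ψ i)⁻¹ := by
    have : α * (a - (ψ i)⁻¹) = 0 := by linarith
    have := (mul_eq_zero.1 this).resolve_left h0.ne'
    linarith
  rw [h2, mul_inv_cancel₀ hi.ne']

open MatrixOrder in
lemma exists_pos_mul_le_dotProduct_mulVec (hC : C.PosDef) :
    ∃ c : ℝ, 0 < c ∧ ∀ x, c * (x ⬝ᵥ x) ≤ x ⬝ᵥ (C *ᵥ x) := by
  rcases isEmpty_or_nonempty (Fin n) with hn | hn
  · exact ⟨1, one_pos, fun x => by simp [dotProduct]⟩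
  obtain ⟨c, hc, h⟩ := (CFC.exists_pos_algebraMap_le_iff
    (hC.isStrictlyPositive.isSelfAdjoint)).2 fun x hx => hC.isStrictlyPositive.spectrum_pos hx
  refine ⟨c, hc, fun x => ?_⟩
  have := (Matrix.le_iff.1 h).dotProduct_mulVec_nonneg x
  simp only [star_trivial, Matrix.sub_mulVec, dotProduct_sub, Algebra.algebraMap_eq_smul_one,
    Matrix.smul_mulVec, Matrix.one_mulVec, dotProduct_smul, smul_eq_mul] at this
  linarith

/-- With `C ≥ c I`, monotonicity of the determinant bounds the potential below by a sum of
one-variable functions; this is the source of coercivity. -/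
lemma exists_le_renyiPotential (hC : C.PosDef) (h0 : 0 < α) (h1 : α < 1) :
    ∃ c : ℝ, 0 < c ∧ ∀ ψ : Fin n → ℝ, (∀ i, 0 < ψ i) →
      ∑ i, (Real.log (α * ψ i + (1 - α) * c) - α * Real.log (ψ i)) ≤ renyiPotential C α ψ := by
  obtain ⟨c, hc, h⟩ := exists_pos_mul_le_dotProduct_mulVec hC
  refine ⟨c, hc, fun ψ hψ => ?_⟩
  have h1' := sub_pos.2 h1
  have hp : ∀ i, 0 < α * ψ i + (1 - α) * c := fun i =>
    add_pos (mul_pos h0 (hψ i)) (mul_pos h1' hc)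
  have hdet := det_le_det_of_forall_dotProduct_le (posDef_diagonal hp)
    (posDef_interpolant hC h0 h1 hψ) fun x => by
      rw [dotProduct_interpolant_mulVec]
      have h2 := mul_le_mul_of_nonneg_left (h x) h1'.le
      have e : x ⬝ᵥ (Matrix.diagonal (fun i => α * ψ i + (1 - α) * c) *ᵥ x) =
          α * ∑ j, ψ j * x j ^ 2 + (1 - α) * (c * (x ⬝ᵥ x)) := by
        simp only [dotProduct, Matrix.mulVec_diagonal, Finset.mul_sum, ← Finset.sum_add_distrib]
        exact Finset.sum_congr rfl fun j _ => by ring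
      linarith
  have hlog := Real.log_le_log (posDef_diagonal hp).det_pos hdet
  rw [log_det_diagonal hp] at hlog
  rw [Finset.sum_sub_distrib, renyiPotential, Finset.mul_sum]
  linarith

end stationary

/-! ### Coercive minimization and minimizing sequences. -/

section coercive

variable {X : Type*} [PseudoMetricSpace X] [ProperSpace X] {s : Set X} {f : X → ℝ}

lemma exists_forall_le_of_isBounded_sublevel (hs : IsClosed s) (hne : s.Nonempty)
    (hf : ContinuousOn f s) (hb : ∀ a, Bornology.IsBounded {x ∈ s | f x ≤ a}) :
    ∃ x ∈ s, ∀ y ∈ s, f x ≤ f y := by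
  obtain ⟨x₀, hx₀⟩ := hne
  have hK : IsCompact {x ∈ s | f x ≤ f x₀} :=
    Metric.isCompact_of_isClosed_isBounded (hf.preimage_isClosed_of_isClosed hs isClosed_Iic)
      (hb _)
  obtain ⟨x, hx, hmin⟩ := hK.exists_isMinOn ⟨x₀, hx₀, le_rfl⟩ (hf.mono fun _ h => h.1)
  refine ⟨x, hx.1, fun y hy => ?_⟩
  by_cases h : f y ≤ f x₀
  · exact hmin ⟨hy, h⟩
  · exact hx.2.trans (not_le.1 h).le

/-- Outside a neighborhood of `x₀`, a sublevel set is compact, so `f` has a minimum there, strictly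
above `f x₀`; eventually the sequence lies below that value. -/
lemma tendsto_of_tendsto_unique_min {x₀ : X} (hs : IsClosed s) (hf : ContinuousOn f s)
    (hb : ∀ a, Bornology.IsBounded {x ∈ s | f x ≤ a}) (huniq : ∀ x ∈ s, f x ≤ f x₀ → x = x₀)
    {x : ℕ → X} (hx : ∀ k, x k ∈ s) (hlim : Tendsto (fun k => f (x k)) atTop (𝓝 (f x₀))) :
    Tendsto x atTop (𝓝 x₀) := by
  rw [tendsto_nhds]
  intro U hU hx₀
  have hK : IsCompact ({y ∈ s | f y ≤ f x₀ + 1} \ U) :=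
    (Metric.isCompact_of_isClosed_isBounded (hf.preimage_isClosed_of_isClosed hs isClosed_Iic)
      (hb _)).diff hU
  have h1 : ∀ᶠ k in atTop, f (x k) < f x₀ + 1 := hlim.eventually_lt_const (by linarith)
  rcases ({y ∈ s | f y ≤ f x₀ + 1} \ U).eq_empty_or_nonempty with he | hne
  · filter_upwards [h1] with k hk
    by_contra hkU
    exact Set.eq_empty_iff_forall_notMem.1 he (x k) ⟨⟨hx k, hk.le⟩, hkU⟩
  · obtain ⟨y, hy, hmin⟩ := hK.exists_isMinOn hne (hf.mono fun _ h => h.1.1)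
    have hlt : f x₀ < f y := by
      by_contra! h
      exact hy.2 (huniq y hy.1.1 h ▸ hx₀)
    filter_upwards [h1, hlim.eventually_lt_const hlt] with k hk hk'
    by_contra hkU
    exact absurd (hmin ⟨⟨hx k, hk.le⟩, hkU⟩) (not_le.2 hk')

end coercive

lemma isBounded_sublevel_pi {n : ℕ} {s : Set (Fin n → ℝ)} {f : (Fin n → ℝ) → ℝ} {c K : ℝ}
    (hc : 0 < c) (h : ∀ x ∈ s, ∀ i, c * |x i| - K ≤ f x) (a : ℝ) :
    Bornology.IsBounded {x ∈ s | f x ≤ a} := by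
  refine (Metric.isBounded_closedBall (x := (0 : Fin n → ℝ)) (r := |(a + K) / c|)).subset ?_
  rintro x ⟨hx, hxa⟩
  rw [mem_closedBall_zero_iff, pi_norm_le_iff_of_nonneg (abs_nonneg _)]
  intro i
  refine le_trans ?_ (le_abs_self _)
  rw [Real.norm_eq_abs, le_div_iff₀ hc]
  have := h x hx i
  linarith

/-- Sufficient conditions for `v` to be the unique vector of optimal variances. -/
lemma isOptimalVariances_iff {n : ℕ} {D : Divergence n} {p : E n → ℝ} {μ : E n}
    {f : (Fin n → ℝ) → ℝ} (hD : IsMeanProfile D p μ f) {L : ℝ} {v : Fin n → ℝ≥0∞}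
    (hL : ∀ ψ : Fin n → ℝ, (∀ i, 0 < ψ i) → L ≤ f ψ)
    (hex : ∃ ψ : ℕ → Fin n → ℝ, (∀ k i, 0 < ψ k i) ∧ Tendsto (fun k => f (ψ k)) atTop (𝓝 L) ∧
      ∀ i, Tendsto (fun k => ENNReal.ofReal (ψ k i)) atTop (𝓝 (v i)))
    (huniq : ∀ ψ : ℕ → Fin n → ℝ, (∀ k i, 0 < ψ k i) →
      Tendsto (fun k => f (ψ k)) atTop (𝓝 L) →
      ∀ i, Tendsto (fun k => ENNReal.ofReal (ψ k i)) atTop (𝓝 (v i))) (w : Fin n → ℝ≥0∞) :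
    IsOptimalVariances D p w ↔ w = v := by
  obtain ⟨ψ₀, hψ₀, hlim₀, hv₀⟩ := hex
  have hglb : IsGLB ((fun q => D q p) '' factorizedFamily n) L := by
    constructor
    · rintro _ ⟨_, ⟨ν, ψ, hψ, rfl⟩, rfl⟩
      exact (hL ψ hψ).trans ((hD ψ hψ).2 ν)
    · intro b hb
      refine ge_of_tendsto' hlim₀ fun k => ?_
      rw [← (hD _ (hψ₀ k)).1]
      exact hb ⟨_, ⟨μ, ψ₀ k, hψ₀ k, rfl⟩, rfl⟩
  constructor
  · rintro ⟨ν, ψ, L', hψ, hglb', hlim, hw⟩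
    obtain rfl := hglb.unique hglb'
    -- The means along the sequence are arbitrary, but the profile is squeezed between `L` and the
    -- divergence.
    have hf : Tendsto (fun k => f (ψ k)) atTop (𝓝 L) :=
      tendsto_of_tendsto_of_tendsto_of_le_of_le tendsto_const_nhds hlim
        (fun k => hL _ (hψ k)) fun k => (hD _ (hψ k)).2 (ν k)
    exact funext fun i => tendsto_nhds_unique (hw i) (huniq ψ hψ hf i)
  · rintro rfl
    refine ⟨fun _ => μ, ψ₀, L, hψ₀, hglb, ?_, hv₀⟩
    simpa only [(hD _ (hψ₀ _)).1] using hlim₀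

lemma abs_le_exp_sub (t : ℝ) : |t| ≤ Real.exp t - t := by
  rcases le_total 0 t with h | h
  · rw [abs_of_nonneg h]
    have := Real.quadratic_le_exp_of_nonneg h
    nlinarith [sq_nonneg (t - 1)]
  · rw [abs_of_nonpos h]
    linarith [Real.exp_pos t]

lemma tendsto_one_of_tendsto_sub_log {y : ℕ → ℝ} (hy : ∀ k, 0 < y k)
    (h : Tendsto (fun k => y k - Real.log (y k)) atTop (𝓝 1)) : Tendsto y atTop (𝓝 1) := by
  have key : Tendsto (fun k => Real.log (y k)) atTop (𝓝 0) := by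
    -- In the variable `t = log y` the function is `exp t - t`, coercive on the whole line with
    -- unique minimizer `0`.
    refine tendsto_of_tendsto_unique_min (s := Set.univ) (f := fun t => Real.exp t - t)
      isClosed_univ (by fun_prop) (fun a => ?_) (fun t _ ht => ?_) (fun _ => Set.mem_univ _) ?_
    · refine (Metric.isBounded_closedBall (x := (0 : ℝ)) (r := a)).subset ?_
      rintro t ⟨_, ht⟩
      rw [mem_closedBall_zero_iff, Real.norm_eq_abs]
      exact (abs_le_exp_sub t).trans ht
    · by_contra hne
      have := Real.add_one_lt_exp hne
      simp only [Real.exp_zero] at ht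
      linarith
    · simpa only [Real.exp_log (hy _), Real.exp_zero, sub_zero] using h
  have := (Real.continuous_exp.tendsto 0).comp key
  simpa only [Function.comp_def, Real.exp_log (hy _), Real.exp_zero] using this

/-! ### The two Kullback-Leibler divergences. -/

section kl

variable {n : ℕ} {a : Fin n → ℝ}

lemma one_add_log_le_mul_sub_log {a s : ℝ} (ha : 0 < a) (hs : 0 < s) :
    1 + Real.log a ≤ a * s - Real.log s := by
  have := Real.log_le_sub_one_of_pos (mul_pos ha hs)
  rw [Real.log_mul ha.ne' hs.ne'] at this
  linarith

/-- Each coordinate's excess over its minimum is nonnegative, so all of them vanish when their sum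
does. It is applied to variances for the reverse divergence and to inverse variances for the forward
one. -/
lemma tendsto_of_tendsto_sum_mul_sub_log (ha : ∀ i, 0 < a i) {s : ℕ → Fin n → ℝ}
    (hs : ∀ k i, 0 < s k i)
    (h : Tendsto (fun k => ∑ i, (a i * s k i - Real.log (s k i))) atTop
      (𝓝 (∑ i, (1 + Real.log (a i))))) (i : Fin n) :
    Tendsto (fun k => s k i) atTop (𝓝 (a i)⁻¹) := by
  have h0 : Tendsto (fun k => ∑ j, (a j * s k j - Real.log (s k j) - (1 + Real.log (a j)))) atTop
      (𝓝 0) := by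
    simp_rw [Finset.sum_sub_distrib _ (fun j => 1 + Real.log (a j))]
    simpa using h.sub_const (∑ i, (1 + Real.log (a i)))
  have hnn : ∀ k j, 0 ≤ a j * s k j - Real.log (s k j) - (1 + Real.log (a j)) := fun k j =>
    sub_nonneg.2 (one_add_log_le_mul_sub_log (ha j) (hs k j))
  have hi : Tendsto (fun k => a i * s k i - Real.log (s k i) - (1 + Real.log (a i))) atTop
      (𝓝 0) :=
    squeeze_zero (fun k => hnn k i) (fun k => Finset.single_le_sum
      (f := fun j => a j * s k j - Real.log (s k j) - (1 + Real.log (a j)))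
      (fun j _ => hnn k j) (Finset.mem_univ i)) h0
  have hy := tendsto_one_of_tendsto_sub_log (fun k => mul_pos (ha i) (hs k i)) (by
    have := hi.add_const 1
    rw [zero_add] at this
    refine this.congr fun k => ?_
    rw [Real.log_mul (ha i).ne' (hs k i).ne']
    ring)
  have := hy.const_mul (a i)⁻¹
  rw [mul_one] at this
  refine this.congr fun k => ?_
  rw [inv_mul_cancel_left₀ (ha i).ne']

lemma isOptimalVariances_klReverse {n : ℕ} (μ : E n) {C : Matrix (Fin n) (Fin n) ℝ}
    (hC : C.PosDef) (w : Fin n → ℝ≥0∞) :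
    IsOptimalVariances (klReverse n) (gaussianDensity μ C) w ↔
      w = fun i => ENNReal.ofReal (C⁻¹ i i)⁻¹ := by
  have ha : ∀ i, 0 < C⁻¹ i i := fun i => hC.inv.diag_pos
  refine isOptimalVariances_iff (isMeanProfile_klReverse μ hC)
    (L := (1 / 2) * (Real.log C.det - n + ∑ i, (1 + Real.log (C⁻¹ i i)))) (fun ψ hψ => ?_)
    ⟨fun _ i => (C⁻¹ i i)⁻¹, fun _ i => inv_pos.2 (ha i), ?_, fun i => tendsto_const_nhds⟩
    (fun ψ hψ h i => ENNReal.tendsto_ofReal ?_) w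
  · have := Finset.sum_le_sum fun i (_ : i ∈ Finset.univ) =>
      one_add_log_le_mul_sub_log (ha i) (hψ i)
    linarith
  · simp only [mul_inv_cancel₀ (ha _).ne', Real.log_inv, sub_neg_eq_add]
    exact tendsto_const_nhds
  · refine tendsto_of_tendsto_sum_mul_sub_log ha hψ ?_ i
    have := (h.const_mul 2).sub_const (Real.log C.det - n)
    convert! this using 2 <;> ring

lemma isOptimalVariances_klForward {n : ℕ} (μ : E n) {C : Matrix (Fin n) (Fin n) ℝ}
    (hC : C.PosDef) (w : Fin n → ℝ≥0∞) :
    IsOptimalVariances (klForward n) (gaussianDensity μ C) w ↔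
      w = fun i => ENNReal.ofReal (C i i) := by
  have ha : ∀ i, 0 < C i i := fun i => hC.diag_pos
  refine isOptimalVariances_iff (isMeanProfile_klForward μ hC)
    (L := (1 / 2) * (-Real.log C.det - n + ∑ i, (1 + Real.log (C i i)))) (fun ψ hψ => ?_)
    ⟨fun _ i => C i i, fun _ i => ha i, ?_, fun i => tendsto_const_nhds⟩
    (fun ψ hψ h i => ENNReal.tendsto_ofReal ?_) w
  · have := Finset.sum_le_sum fun i (_ : i ∈ Finset.univ) =>
      one_add_log_le_mul_sub_log (ha i) (inv_pos.2 (hψ i))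
    linarith
  · simp only [mul_inv_cancel₀ (ha _).ne', Real.log_inv, sub_neg_eq_add]
    exact tendsto_const_nhds
  · have := tendsto_of_tendsto_sum_mul_sub_log ha (s := fun k i => (ψ k i)⁻¹)
      (fun k i => inv_pos.2 (hψ k i)) (by
        have := (h.const_mul 2).sub_const (-Real.log C.det - n)
        convert! this using 2 <;> ring) i
    simpa using this.inv₀ (inv_ne_zero (ha i).ne')

end kl

/-! ### Existence and uniqueness for Rényi, in log-variance coordinates. -/

section renyi

variable {n : ℕ} {C : Matrix (Fin n) (Fin n) ℝ} {α : ℝ}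

lemma continuous_renyiPotential_exp (hC : C.PosDef) (h0 : 0 < α) (h1 : α < 1) :
    Continuous fun t : Fin n → ℝ => renyiPotential C α fun i => Real.exp (t i) := by
  have hdet : Continuous fun t : Fin n → ℝ => (interpolant C α fun i => Real.exp (t i)).det := by
    unfold interpolant
    refine Continuous.matrix_det (Continuous.add (Continuous.const_smul ?_ α) continuous_const)
    exact Continuous.matrix_diagonal (by fun_prop)
  simp only [renyiPotential, Real.log_exp]
  refine Continuous.sub (hdet.log fun t =>
    (posDef_interpolant hC h0 h1 fun i => Real.exp_pos (t i)).det_pos.ne') (by fun_prop)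

/-- Keeping one summand inside the logarithm gives growth of slope `1 - α` as `t → ∞` and slope `α`
as `t → -∞`; each coordinate costs at most the constant `K`. -/
lemma exists_mul_abs_sub_le_renyiPotential_exp (hC : C.PosDef) (h0 : 0 < α) (h1 : α < 1) :
    ∃ c K : ℝ, 0 < c ∧ ∀ (t : Fin n → ℝ) (i : Fin n),
      c * |t i| - K ≤ renyiPotential C α fun i => Real.exp (t i) := by
  obtain ⟨l, hl, h⟩ := exists_le_renyiPotential hC h0 h1
  have h1' := sub_pos.2 h1
  set K := |Real.log α| + |Real.log ((1 - α) * l)| with hK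
  have hterm : ∀ t : ℝ, min α (1 - α) * |t| - K ≤
      Real.log (α * Real.exp t + (1 - α) * l) - α * Real.log (Real.exp t) := by
    intro t
    rw [Real.log_exp]
    have hp : 0 < (1 - α) * l := mul_pos h1' hl
    have hq : 0 < α * Real.exp t := mul_pos h0 (Real.exp_pos t)
    have b1 := Real.log_le_log hq (le_add_of_nonneg_right hp.le)
    have b2 := Real.log_le_log hp (le_add_of_nonneg_left hq.le)
    rw [Real.log_mul h0.ne' (Real.exp_pos t).ne', Real.log_exp] at b1
    have k1 := neg_abs_le (Real.log α)
    have k2 := neg_abs_le (Real.log ((1 - α) * l))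
    have k3 := abs_nonneg (Real.log α)
    have k4 := abs_nonneg (Real.log ((1 - α) * l))
    rcases le_total 0 t with ht | ht
    · rw [abs_of_nonneg ht]
      have := mul_le_mul_of_nonneg_right (min_le_right α (1 - α)) ht
      linarith
    · rw [abs_of_nonpos ht]
      have := mul_le_mul_of_nonneg_right (min_le_left α (1 - α)) (neg_nonneg.2 ht)
      linarith
  refine ⟨min α (1 - α), n * K, lt_min h0 h1', fun t i => ?_⟩
  refine le_trans ?_ (h _ fun i => Real.exp_pos (t i))
  have hsum := Finset.sum_le_sum fun j (_ : j ∈ Finset.univ) => hterm (t j)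
  refine le_trans ?_ hsum
  rw [Finset.sum_sub_distrib, Finset.sum_const, Finset.card_univ, Fintype.card_fin, nsmul_eq_mul]
  have := Finset.single_le_sum (f := fun j => min α (1 - α) * |t j|)
    (fun j _ => mul_nonneg (lt_min h0 h1').le (abs_nonneg _)) (Finset.mem_univ i)
  linarith

/-- The unique minimizer of the Rényi potential. -/
lemma exists_renyi_variances (hC : C.PosDef) (h0 : 0 < α) (h1 : α < 1) :
    ∃ ψ : Fin n → ℝ, (∀ i, 0 < ψ i) ∧ IsRenyiStationary C α ψ ∧
      (∀ φ : Fin n → ℝ, (∀ i, 0 < φ i) → renyiPotential C α ψ ≤ renyiPotential C α φ) ∧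
      ∀ φ : ℕ → Fin n → ℝ, (∀ k i, 0 < φ k i) →
        Tendsto (fun k => renyiPotential C α (φ k)) atTop (𝓝 (renyiPotential C α ψ)) →
        ∀ i, Tendsto (fun k => φ k i) atTop (𝓝 (ψ i)) := by
  obtain ⟨c, K, hc, hK⟩ := exists_mul_abs_sub_le_renyiPotential_exp hC h0 h1
  have hcont := continuous_renyiPotential_exp hC h0 h1
  have hb := isBounded_sublevel_pi (s := Set.univ)
    (f := fun t : Fin n → ℝ => renyiPotential C α fun i => Real.exp (t i)) hc fun t _ => hK t
  obtain ⟨t, -, ht⟩ := exists_forall_le_of_isBounded_sublevel isClosed_univ Set.univ_nonempty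
    hcont.continuousOn hb
  have hpos : ∀ i, 0 < Real.exp (t i) := fun i => Real.exp_pos _
  have hlog : ∀ φ : Fin n → ℝ, (∀ i, 0 < φ i) → (fun i => Real.exp (Real.log (φ i))) = φ :=
    fun φ hφ => funext fun i => Real.exp_log (hφ i)
  have hmin : ∀ φ : Fin n → ℝ, (∀ i, 0 < φ i) →
      renyiPotential C α (fun i => Real.exp (t i)) ≤ renyiPotential C α φ := by
    intro φ hφ
    have := ht (fun i => Real.log (φ i)) (Set.mem_univ _)
    rwa [hlog φ hφ] at this
  have hstat := isRenyiStationary_of_isMin hC h0 h1 hpos hmin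
  refine ⟨fun i => Real.exp (t i), hpos, hstat, hmin, fun φ hφ hlim i => ?_⟩
  have huniq : ∀ u ∈ Set.univ, (renyiPotential C α fun i => Real.exp (u i)) ≤
      (renyiPotential C α fun i => Real.exp (t i)) → u = t := by
    intro u _ hu
    have hustat := isRenyiStationary_of_isMin hC h0 h1 (fun i => Real.exp_pos (u i))
      fun φ hφ => hu.trans (hmin φ hφ)
    have := isRenyiStationary_unique hC h0 h1 (fun i => Real.exp_pos (u i)) hpos hustat hstat
    exact funext fun i => Real.exp_injective (congrFun this i)
  have hconv := tendsto_of_tendsto_unique_min isClosed_univ hcont.continuousOn hb huniq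
    (x := fun k i => Real.log (φ k i)) (fun _ => Set.mem_univ _)
    (by simpa only [hlog _ (hφ _)] using hlim)
  have := (Real.continuous_exp.tendsto (t i)).comp ((tendsto_pi_nhds.1 hconv) i)
  simpa only [Function.comp_def, Real.exp_log (hφ _ i)] using this

lemma exists_isMinimizer_renyi (μ : E n) (hC : C.PosDef) (h0 : 0 < α) (h1 : α < 1) :
    ∃ ψ : Fin n → ℝ, (∀ i, 0 < ψ i) ∧ IsRenyiStationary C α ψ ∧
      IsMinimizer (renyi n α) (gaussianDensity μ C) μ ψ ∧
      ∀ w, IsOptimalVariances (renyi n α) (gaussianDensity μ C) w ↔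
        w = fun i => ENNReal.ofReal (ψ i) := by
  obtain ⟨ψ, hψ, hstat, hmin, hconv⟩ := exists_renyi_variances hC h0 h1
  have hD := isMeanProfile_renyi μ hC h0 h1
  set c := (1 - α) * Real.log C.det
  set f : (Fin n → ℝ) → ℝ := fun ψ =>
    1 / (α * (α - 1)) * (Real.exp (-(1 / 2) * (renyiPotential C α ψ - c)) - 1) with hf
  have hα : α * (α - 1) < 0 := mul_neg_of_pos_of_neg h0 (by linarith)
  have hneg : 1 / (α * (α - 1)) < 0 := div_neg_of_pos_of_neg one_pos hα
  have hle : ∀ φ : Fin n → ℝ, (∀ i, 0 < φ i) → f ψ ≤ f φ := by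
    intro φ hφ
    apply mul_le_mul_of_nonpos_left _ hneg.le
    have := hmin φ hφ
    gcongr ?_ - _
    apply Real.exp_le_exp.2
    linarith
  have hexp : ∀ φ, 1 + α * (α - 1) * f φ =
      Real.exp (-(1 / 2) * (renyiPotential C α φ - c)) := by
    intro φ
    simp only [hf]
    rw [← mul_assoc, mul_one_div_cancel hα.ne]
    ring
  -- Inverting the exponential turns convergence of the divergence into convergence of the
  -- potential.
  have hinv : ∀ φ, renyiPotential C α φ = c - 2 * Real.log (1 + α * (α - 1) * f φ) := by
    intro φ
    rw [hexp, Real.log_exp]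
    ring
  refine ⟨ψ, hψ, hstat, ⟨hψ, ?_⟩, isOptimalVariances_iff hD (L := f ψ) hle
    ⟨fun _ => ψ, fun _ => hψ, tendsto_const_nhds, fun _ => tendsto_const_nhds⟩ ?_⟩
  · rintro _ ⟨ν, φ, hφ, rfl⟩
    rw [(hD ψ hψ).1]
    exact (hle φ hφ).trans ((hD φ hφ).2 ν)
  · intro φ hφ hlim i
    refine ENNReal.tendsto_ofReal (hconv φ hφ ?_ i)
    simp only [hinv]
    have hpos : 1 + α * (α - 1) * f ψ ≠ 0 := by
      rw [hexp]
      exact (Real.exp_pos _).ne'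
    exact (((hlim.const_mul _).const_add 1).log hpos).const_mul 2 |>.const_sub c

end renyi

/-! ### The score divergences as a quadratic program on the orthant. -/

section score

variable {n : ℕ} {A : Matrix (Fin n) (Fin n) ℝ}

lemma scoreQuadratic_eq (A : Matrix (Fin n) (Fin n) ℝ) (s : Fin n → ℝ) :
    scoreQuadratic A s = n - 2 * ∑ i, A i i * s i + s ⬝ᵥ ((A ⊙ A) *ᵥ s) := by
  rw [scoreQuadratic]
  congr 1
  simp only [dotProduct, Matrix.mulVec, Matrix.hadamard_apply, Finset.mul_sum]
  exact Finset.sum_congr rfl fun i _ => Finset.sum_congr rfl fun j _ => by ring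

lemma continuous_scoreQuadratic (A : Matrix (Fin n) (Fin n) ℝ) :
    Continuous (scoreQuadratic A) := by
  unfold scoreQuadratic
  fun_prop

/-- Exact second-order expansion, used for uniqueness and for one-sided optimality. -/
lemma scoreQuadratic_add (hA : A.PosDef) (s d : Fin n → ℝ) :
    scoreQuadratic A (s + d) = scoreQuadratic A s + 2 * (d ⬝ᵥ ((A ⊙ A) *ᵥ s - A.diag)) +
      d ⬝ᵥ ((A ⊙ A) *ᵥ d) := by
  have h : ∑ i, A i i * (s + d) i = ∑ i, A i i * s i + d ⬝ᵥ A.diag := by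
    simp only [dotProduct, ← Finset.sum_add_distrib, Pi.add_apply, Matrix.diag]
    exact Finset.sum_congr rfl fun i _ => by ring
  rw [scoreQuadratic_eq, scoreQuadratic_eq, h, add_comm s d,
    dotProduct_mulVec_add (hA.hadamard hA).isHermitian, dotProduct_sub]
  ring

/-- On the orthant the off-diagonal terms are nonnegative and can be dropped. -/
lemma sum_sq_le_scoreQuadratic {s : Fin n → ℝ} (hs : ∀ i, 0 ≤ s i) :
    ∑ i, (A i i * s i - 1) ^ 2 ≤ scoreQuadratic A s := by
  have h : ∑ i, (A i i * s i) ^ 2 ≤ ∑ i, ∑ j, s i * s j * A i j ^ 2 := by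
    refine Finset.sum_le_sum fun i _ => ?_
    have := Finset.single_le_sum (f := fun j => s i * s j * A i j ^ 2)
      (fun j _ => mul_nonneg (mul_nonneg (hs i) (hs j)) (sq_nonneg _)) (Finset.mem_univ i)
    refine le_trans (le_of_eq ?_) this
    ring
  have e : ∑ i, (A i i * s i - 1) ^ 2 = n - 2 * ∑ i, A i i * s i + ∑ i, (A i i * s i) ^ 2 := by
    have : (n : ℝ) = ∑ _i : Fin n, (1 : ℝ) := by simp
    rw [this, Finset.mul_sum, ← Finset.sum_sub_distrib, ← Finset.sum_add_distrib]
    exact Finset.sum_congr rfl fun i _ => by ring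
  rw [e, scoreQuadratic]
  linarith

/-- The minimizer of `scoreQuadratic` over the closed orthant. -/
lemma exists_scoreQuadratic_minimizer (hA : A.PosDef) :
    ∃ s : Fin n → ℝ, (∀ i, 0 ≤ s i) ∧
      (∀ x : Fin n → ℝ, (∀ i, 0 ≤ x i) → scoreQuadratic A s ≤ scoreQuadratic A x) ∧
      ∀ x : ℕ → Fin n → ℝ, (∀ k i, 0 ≤ x k i) →
        Tendsto (fun k => scoreQuadratic A (x k)) atTop (𝓝 (scoreQuadratic A s)) →
        ∀ i, Tendsto (fun k => x k i) atTop (𝓝 (s i)) := by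
  set S : Set (Fin n → ℝ) := Set.Ici 0 with hS
  have hmem : ∀ x : Fin n → ℝ, x ∈ S ↔ ∀ i, 0 ≤ x i := fun x => by
    rw [hS, Set.mem_Ici, Pi.le_def]; rfl
  have hcl : IsClosed S := isClosed_Ici
  obtain ⟨c, hc, hcA⟩ := exists_pos_mul_le_dotProduct_mulVec hA
  have hcd : ∀ i, c ≤ A i i := fun i => by simpa using hcA (Pi.single i 1)
  -- The constants come from `(t - 1) ^ 2 ≥ 2 * t - 3` with `t = A i i * x i`.
  have hb := isBounded_sublevel_pi (s := S) (f := scoreQuadratic A) (c := 2 * c) (K := 3)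
    (by positivity) fun x hx i => by
      rw [hmem] at hx
      have h1 := sum_sq_le_scoreQuadratic (A := A) hx
      have h2 := Finset.single_le_sum (f := fun j => (A j j * x j - 1) ^ 2)
        (fun j _ => sq_nonneg _) (Finset.mem_univ i)
      have h3 := mul_le_mul_of_nonneg_right (hcd i) (hx i)
      rw [abs_of_nonneg (hx i)]
      nlinarith [sq_nonneg (A i i * x i - 2)]
  have hcont := (continuous_scoreQuadratic A).continuousOn (s := S)
  obtain ⟨s, hs, hmin⟩ := exists_forall_le_of_isBounded_sublevel hcl
    ⟨0, (hmem 0).2 fun _ => le_rfl⟩ hcont hb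
  refine ⟨s, (hmem s).1 hs, fun x hx => hmin x ((hmem x).2 hx), fun x hx hlim => ?_⟩
  refine tendsto_pi_nhds.1 (tendsto_of_tendsto_unique_min hcl hcont hb ?_
    (fun k => (hmem _).2 (hx k)) hlim)
  intro y hy hle
  by_contra hne
  have hd : y - s ≠ 0 := sub_ne_zero.2 hne
  have hpos := dotProduct_mulVec_pos (hA.hadamard hA) hd
  -- A second minimizer `y` would make the midpoint strictly better, by strict convexity.
  have hmid : s + (1 / 2 : ℝ) • (y - s) ∈ S := by
    rw [hmem] at hs hy ⊢
    intro i
    have := hs i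
    have := hy i
    simp only [Pi.add_apply, Pi.smul_apply, Pi.sub_apply, smul_eq_mul]
    linarith
  have h1 := hmin _ hmid
  have h2 := scoreQuadratic_add hA s (y - s)
  rw [scoreQuadratic_add hA, Matrix.mulVec_smul, smul_dotProduct, smul_dotProduct,
    dotProduct_smul] at h1
  rw [add_sub_cancel] at h2
  simp only [smul_eq_mul] at h1
  linarith

/-- Half of the KKT conditions: a positive coordinate may be decreased, so the partial derivative
there is at most `0`. -/
lemma scoreQuadratic_minimizer_bound (hA : A.PosDef) {s : Fin n → ℝ} (hs : ∀ i, 0 ≤ s i)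
    (hmin : ∀ x : Fin n → ℝ, (∀ i, 0 ≤ x i) → scoreQuadratic A s ≤ scoreQuadratic A x)
    {i : Fin n} (hi : 0 < s i) : ∑ j, A i j ^ 2 * s j ≤ A i i := by
  have hii : 0 < A i i := hA.diag_pos
  set d := ∑ j, A i j ^ 2 * s j - A i i with hd
  by_contra! hlt
  have hd0 : 0 < d := by linarith
  -- The first bound keeps the point in the orthant; the second keeps the quadratic cost below the
  -- linear gain `2 * ε * d`.
  set ε := min (s i) (d / A i i ^ 2) with hε
  have hε0 : 0 < ε := lt_min hi (by positivity)
  have hεd : ε * A i i ^ 2 ≤ d := by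
    rw [← le_div_iff₀ (by positivity)]
    exact min_le_right _ _
  have h := hmin (s + Pi.single i (-ε)) fun j => by
    by_cases hj : j = i
    · subst hj
      simp [hε]
    · simpa [Pi.single_eq_of_ne hj] using hs j
  rw [scoreQuadratic_add hA, single_dotProduct, single_dotProduct, Pi.sub_apply] at h
  have e1 : ((A ⊙ A) *ᵥ s) i = ∑ j, A i j ^ 2 * s j := by
    simp only [Matrix.mulVec, dotProduct, Matrix.hadamard_apply, sq]
  have e2 : ((A ⊙ A) *ᵥ Pi.single i (-ε)) i = -(A i i ^ 2 * ε) := by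
    simp [Matrix.hadamard_apply, sq]
  rw [e1, e2, Matrix.diag_apply, ← hd] at h
  nlinarith

lemma scoreQuadratic_minimizer_le (hA : A.PosDef) {s : Fin n → ℝ} (hs : ∀ i, 0 ≤ s i)
    (hmin : ∀ x : Fin n → ℝ, (∀ i, 0 ≤ x i) → scoreQuadratic A s ≤ scoreQuadratic A x)
    (i : Fin n) : s i ≤ (A i i)⁻¹ := by
  have hii : 0 < A i i := hA.diag_pos
  rcases (hs i).eq_or_lt with h | h
  · rw [← h]; positivity
  · have h1 := scoreQuadratic_minimizer_bound hA hs hmin h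
    have h2 := Finset.single_le_sum (f := fun j => A i j ^ 2 * s j)
      (fun j _ => mul_nonneg (sq_nonneg _) (hs j)) (Finset.mem_univ i)
    rw [le_inv_comm₀ h hii, ← one_div, le_div_iff₀ h]
    have h3 : A i i * (A i i * s i) ≤ A i i * 1 := by
      nlinarith
    exact le_of_mul_le_mul_left h3 hii

/-- If equality held for all `i`, every coordinate would be positive and the diagonal term alone
would saturate the KKT bound, leaving no room for off-diagonal entries. -/
lemma exists_scoreQuadratic_minimizer_lt (hA : A.PosDef) (hdiag : ¬ A.IsDiag) {s : Fin n → ℝ}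
    (hs : ∀ i, 0 ≤ s i)
    (hmin : ∀ x : Fin n → ℝ, (∀ i, 0 ≤ x i) → scoreQuadratic A s ≤ scoreQuadratic A x) :
    ∃ i, s i < (A i i)⁻¹ := by
  by_contra! h
  apply hdiag
  have hii : ∀ i, 0 < A i i := fun i => hA.diag_pos
  have heq : ∀ i, s i = (A i i)⁻¹ := fun i =>
    le_antisymm (scoreQuadratic_minimizer_le hA hs hmin i) (h i)
  have hpos : ∀ i, 0 < s i := fun i => by rw [heq]; exact inv_pos.2 (hii i)
  intro i j hij
  have h1 := scoreQuadratic_minimizer_bound hA hs hmin (hpos i)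
  rw [← Finset.add_sum_erase _ _ (Finset.mem_univ i)] at h1
  have h2 := Finset.single_le_sum (s := Finset.univ.erase i) (f := fun j => A i j ^ 2 * s j)
      (fun j _ => mul_nonneg (sq_nonneg _) (hs j))
      (Finset.mem_erase.2 ⟨hij.symm, Finset.mem_univ j⟩)
  have h3 : A i i ^ 2 * s i = A i i := by
    rw [heq i]
    have := (hii i).ne'
    field_simp
  have h4 : A i j ^ 2 * s j ≤ 0 := by linarith
  by_contra hne
  have : 0 < A i j ^ 2 * s j := mul_pos (by positivity) (hpos j)
  linarith

/-- Approaches a possibly boundary minimizer from inside the open orthant, as members of `𝒬` have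
positive variances. -/
lemma tendsto_add_one_div (s : Fin n → ℝ) :
    Tendsto (fun (k : ℕ) i => s i + 1 / ((k : ℝ) + 1)) atTop (𝓝 s) := by
  refine tendsto_pi_nhds.2 fun i => ?_
  simpa using (tendsto_one_div_add_atTop_nhds_zero_nat (𝕜 := ℝ)).const_add (s i)

lemma exists_isOptimalVariances_scoreReverse (μ : E n) {C : Matrix (Fin n) (Fin n) ℝ}
    (hC : C.PosDef) (hd : ¬ C⁻¹.IsDiag) : ∃ v : Fin n → ℝ≥0∞,
      (∀ w, IsOptimalVariances (scoreReverse n) (gaussianDensity μ C) w ↔ w = v) ∧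
      (∀ i, v i ≤ ENNReal.ofReal (C⁻¹ i i)⁻¹) ∧ ∃ i, v i < ENNReal.ofReal (C⁻¹ i i)⁻¹ := by
  have hA := hC.inv
  obtain ⟨s, hs, hmin, hconv⟩ := exists_scoreQuadratic_minimizer hA
  refine ⟨fun i => ENNReal.ofReal (s i), ?_, fun i => ENNReal.ofReal_le_ofReal
    (scoreQuadratic_minimizer_le hA hs hmin i), ?_⟩
  · have hlim := tendsto_add_one_div s
    refine isOptimalVariances_iff (isMeanProfile_scoreReverse μ hC) (L := scoreQuadratic C⁻¹ s)
      (fun ψ hψ => hmin ψ fun i => (hψ i).le) ⟨fun k i => s i + 1 / ((k : ℝ) + 1), fun k i =>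
        add_pos_of_nonneg_of_pos (hs i) (by positivity),
        ((continuous_scoreQuadratic C⁻¹).tendsto s).comp hlim, fun i =>
        ENNReal.tendsto_ofReal (tendsto_pi_nhds.1 hlim i)⟩ fun ψ hψ h i =>
        ENNReal.tendsto_ofReal (hconv ψ (fun k i => (hψ k i).le) h i)
  · obtain ⟨i, hi⟩ := exists_scoreQuadratic_minimizer_lt hA hd hs hmin
    exact ⟨i, (ENNReal.ofReal_lt_ofReal_iff (inv_pos.2 hA.diag_pos)).2 hi⟩

/-- The minimizer `s` consists of inverse variances; inversion in `ℝ≥0∞` turns `s i = 0` into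
variance `∞` and reverses the inequalities. -/
lemma exists_isOptimalVariances_scoreForward (μ : E n) {C : Matrix (Fin n) (Fin n) ℝ}
    (hC : C.PosDef) (hd : ¬ C.IsDiag) : ∃ v : Fin n → ℝ≥0∞,
      (∀ w, IsOptimalVariances (scoreForward n) (gaussianDensity μ C) w ↔ w = v) ∧
      (∀ i, ENNReal.ofReal (C i i) ≤ v i) ∧ ∃ i, ENNReal.ofReal (C i i) < v i := by
  obtain ⟨s, hs, hmin, hconv⟩ := exists_scoreQuadratic_minimizer hC
  have hii : ∀ i, 0 < C i i := fun i => hC.diag_pos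
  have hinv : ∀ i, ENNReal.ofReal (C i i) = (ENNReal.ofReal (C i i)⁻¹)⁻¹ := fun i => by
    rw [ENNReal.ofReal_inv_of_pos (hii i), inv_inv]
  refine ⟨fun i => (ENNReal.ofReal (s i))⁻¹, ?_, fun i => ?_, ?_⟩
  · have hlim := tendsto_add_one_div s
    have hpos : ∀ (k : ℕ) (i : Fin n), 0 < s i + 1 / ((k : ℝ) + 1) := fun k i =>
      add_pos_of_nonneg_of_pos (hs i) (by positivity)
    refine isOptimalVariances_iff (isMeanProfile_scoreForward μ hC) (L := scoreQuadratic C s)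
      (fun ψ hψ => hmin _ fun i => (inv_pos.2 (hψ i)).le)
      ⟨fun k i => (s i + 1 / ((k : ℝ) + 1))⁻¹, fun k i => inv_pos.2 (hpos k i), ?_, fun i => ?_⟩
      fun ψ hψ h i => ?_
    · simp only [inv_inv]
      exact ((continuous_scoreQuadratic C).tendsto s).comp hlim
    · simp only [ENNReal.ofReal_inv_of_pos (hpos _ _)]
      exact (ENNReal.tendsto_ofReal (tendsto_pi_nhds.1 hlim i)).inv
    · have := (ENNReal.tendsto_ofReal (hconv (fun k i => (ψ k i)⁻¹)
        (fun k i => (inv_pos.2 (hψ k i)).le) h i)).inv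
      simpa only [ENNReal.ofReal_inv_of_pos (hψ _ _), inv_inv] using this
  · rw [hinv, ENNReal.inv_le_inv]
    exact ENNReal.ofReal_le_ofReal (scoreQuadratic_minimizer_le hC hs hmin i)
  · obtain ⟨i, hi⟩ := exists_scoreQuadratic_minimizer_lt hC hd hs hmin
    refine ⟨i, ?_⟩
    rw [hinv, ENNReal.inv_lt_inv]
    exact (ENNReal.ofReal_lt_ofReal_iff (inv_pos.2 (hii i))).2 hi

end score

/-! ### The links of the chain of dominations. -/

lemma isDiag_of_isDiag_inv {n : ℕ} {C : Matrix (Fin n) (Fin n) ℝ} (hC : C.PosDef)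
    (h : C⁻¹.IsDiag) : C.IsDiag := by
  have hpos : ∀ i, 0 < C⁻¹.diag i := fun i => hC.inv.diag_pos
  have e := inv_diagonal_of_pos hpos
  rw [h.diagonal_diag, Matrix.nonsing_inv_nonsing_inv _ hC.det_pos.ne'.isUnit] at e
  rw [e]
  exact Matrix.isDiag_diagonal _

lemma dominates_klReverse_scoreReverse (n : ℕ) :
    Dominates (klReverse n) (scoreReverse n) := by
  intro μ C hC hd
  obtain ⟨v, hv, hle, hlt⟩ := exists_isOptimalVariances_scoreReverse μ hC
    fun h => hd (isDiag_of_isDiag_inv hC h)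
  exact ⟨_, v, isOptimalVariances_klReverse μ hC, hv, hle, hlt⟩

lemma dominates_scoreForward_klForward (n : ℕ) :
    Dominates (scoreForward n) (klForward n) := by
  intro μ C hC hd
  obtain ⟨v, hv, hle, hlt⟩ := exists_isOptimalVariances_scoreForward μ hC hd
  exact ⟨v, _, hv, isOptimalVariances_klForward μ hC, hle, hlt⟩

lemma dominates_renyi_klReverse (n : ℕ) {α : ℝ} (h0 : 0 < α) (h1 : α < 1) :
    Dominates (renyi n α) (klReverse n) := by
  intro μ C hC hd
  obtain ⟨ψ, hψ, hstat, -, hopt⟩ := exists_isMinimizer_renyi μ hC h0 h1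
  have hb := inv_inv_le_of_isRenyiStationary hC h0 h1 hψ hstat
  obtain ⟨i, hi⟩ := exists_one_lt_mul_inv hC hd
  exact ⟨_, _, hopt, isOptimalVariances_klReverse μ hC,
    fun j => ENNReal.ofReal_le_ofReal (hb j).1,
    i, (ENNReal.ofReal_lt_ofReal_iff (hψ i)).2 ((hb i).2 hi)⟩

lemma dominates_klForward_renyi (n : ℕ) {α : ℝ} (h0 : 0 < α) (h1 : α < 1) :
    Dominates (klForward n) (renyi n α) := by
  intro μ C hC hd
  obtain ⟨ψ, hψ, hstat, -, hopt⟩ := exists_isMinimizer_renyi μ hC h0 h1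
  have hb := le_apply_self_of_isRenyiStationary hC h0 h1 hψ hstat
  obtain ⟨i, hi⟩ := exists_one_lt_mul_inv hC hd
  exact ⟨_, _, isOptimalVariances_klForward μ hC, hopt,
    fun j => ENNReal.ofReal_le_ofReal (hb j).1,
    i, (ENNReal.ofReal_lt_ofReal_iff hC.diag_pos).2 ((hb i).2 hi)⟩

lemma dominates_renyi_renyi (n : ℕ) {α β : ℝ} (h0 : 0 < α) (hαβ : α < β) (h1 : β < 1) :
    Dominates (renyi n β) (renyi n α) := by
  intro μ C hC hd
  obtain ⟨ψ, hψ, hstat, -, hopt⟩ := exists_isMinimizer_renyi μ hC h0 (hαβ.trans h1)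
  obtain ⟨φ, hφ, hstat', -, hopt'⟩ := exists_isMinimizer_renyi μ hC (h0.trans hαβ) h1
  have hb := isRenyiStationary_mono hC h0 hαβ h1 hψ hφ hstat hstat'
  obtain ⟨i, hi⟩ := exists_one_lt_mul_inv hC hd
  exact ⟨_, _, hopt', hopt, fun j => ENNReal.ofReal_le_ofReal (hb j).1,
    i, (ENNReal.ofReal_lt_ofReal_iff (hφ i)).2 ((hb i).2 hi)⟩

end FGVI

theorem theorem2 (n : ℕ) :
    (∀ α₁ α₂ : ℝ, 0 < α₁ → α₁ < α₂ → α₂ < 1 →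
      FGVI.Dominates (FGVI.klReverse n) (FGVI.scoreReverse n) ∧
      FGVI.Dominates (FGVI.renyi n α₁) (FGVI.klReverse n) ∧
      FGVI.Dominates (FGVI.renyi n α₂) (FGVI.renyi n α₁) ∧
      FGVI.Dominates (FGVI.klForward n) (FGVI.renyi n α₂) ∧
      FGVI.Dominates (FGVI.scoreForward n) (FGVI.klForward n)) ∧
    (∀ (μ : FGVI.E n) (C : Matrix (Fin n) (Fin n) ℝ), C.PosDef → ¬ C.IsDiag →
      ∃ Ψ : ℝ → Fin n → ℝ,
        (∀ α ∈ Set.Ioo (0 : ℝ) 1,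
          (∃ ν, FGVI.IsMinimizer (FGVI.renyi n α) (FGVI.gaussianDensity μ C) ν (Ψ α)) ∧
          ∀ v, FGVI.IsOptimalVariances (FGVI.renyi n α) (FGVI.gaussianDensity μ C) v ↔
            v = fun i => ENNReal.ofReal (Ψ α i)) ∧
        ∀ i, 1 < C i i * C⁻¹ i i → StrictMonoOn (fun α => Ψ α i) (Set.Ioo 0 1)) := by
  refine ⟨fun α₁ α₂ h0 h12 h1 => ⟨FGVI.dominates_klReverse_scoreReverse n,
    FGVI.dominates_renyi_klReverse n h0 (h12.trans h1), FGVI.dominates_renyi_renyi n h0 h12 h1,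
    FGVI.dominates_klForward_renyi n (h0.trans h12) h1,
    FGVI.dominates_scoreForward_klForward n⟩, fun μ C hC _ => ?_⟩
  have hex : ∀ α : ℝ, ∃ ψ : Fin n → ℝ, α ∈ Set.Ioo (0 : ℝ) 1 →
      (∀ i, 0 < ψ i) ∧ FGVI.IsRenyiStationary C α ψ ∧
      FGVI.IsMinimizer (FGVI.renyi n α) (FGVI.gaussianDensity μ C) μ ψ ∧
      ∀ w, FGVI.IsOptimalVariances (FGVI.renyi n α) (FGVI.gaussianDensity μ C) w ↔
        w = fun i => ENNReal.ofReal (ψ i) := by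
    intro α
    by_cases hα : α ∈ Set.Ioo (0 : ℝ) 1
    · obtain ⟨ψ, h⟩ := FGVI.exists_isMinimizer_renyi μ hC hα.1 hα.2
      exact ⟨ψ, fun _ => h⟩
    -- A default value outside `(0, 1)`, so that `Ψ` is defined on all of `ℝ`.
    · exact ⟨0, fun h => absurd h hα⟩
  choose Ψ hΨ using hex
  refine ⟨Ψ, fun α hα => ⟨⟨μ, (hΨ α hα).2.2.1⟩, (hΨ α hα).2.2.2⟩, fun i hi α hα β hβ hαβ => ?_⟩
  obtain ⟨hψ, hstat, -⟩ := hΨ α hα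
  obtain ⟨hφ, hstat', -⟩ := hΨ β hβ
  exact (FGVI.isRenyiStationary_mono hC hα.1 hαβ hβ.2 hψ hφ hstat hstat' i).2 hi
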